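/- **Setting.** Let $S$ (scenarios), $J$ (blocks), $K$ (first-stage variables) be finite sets, $K=\bigsqcup_{j\in J}K_j$, let $\pi_s\ge 0$ with $\sum_s\pi_s=1$, and for every $(s,j)$ let a finite directed network with node set $N_{sj}$ and arc set $A_{sj}$ be given. Consider the two-stage stochastic mixed-integer program $$(\star)\qquad \min\ \sum_{k\in K}c_kx_k+\sum_{s\in S}\sum_{j\in J}\pi_s\sum_{a\in A_{sj}}g_ay_a$$ subject to $Ax\ge b$; $x_k\in\mathbb Z$ for $k\in I$, where $I\subseteq K$ (the other $x_k$ are real); and, for all $s,j$, the flow balance $\sum_{m:(n,m)\in A_{sj}}y_{(n,m)}-\sum_{m:(m,n)\in A_{sj}}y_{(m,n)}=\sum_{k\in K_j}b_{nsk}x_k$ for all $n\in N_{sj}$, the side constraints $\sum_{a\in A_{sj}}f_{asj}\,y_a\ge h_{sj}$ with vectors $f_{asj},h_{sj}$, and $y_a\in\mathcal Y_a$ with $\mathcal Y_a\subseteq[0,\infty)$ (such as $\{0,1\}$, $\mathbb Z_{\ge0}$ or $[0,\infty)$). For fixed $x$, the constraints on $y$ form the second-stage problem $\mathrm{SP}(x)$;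 replacing $y_a\in\mathcal Y_a$ by $y_a\ge0$ gives its relaxation, whose optimal value splits as $\overline\Phi(x)=\sum_{s,j}\pi_s\overline\varphi_{sj}(x)$. The dual polyhedron $\mathcal P_{sj}$ of the relaxation is the set of $(\psi,\gamma)$ with $\gamma\ge0$ and $\psi_n-\psi_m+\gamma^\top f_{(n,m)sj}\le g_{(n,m)}$ for all $(n,m)\in A_{sj}$; the dual objective at $x$ is $d_{sj}(x;\psi,\gamma)=\sum_{n}\sum_{k\in K_j}b_{nsk}x_k\psi_n+h_{sj}^\top\gamma$. Assume that $\{x: Ax\ge b\}$ is bounded, that the first-stage variables entering the second stage are integer ($b_{nsk}=0$ whenever $k\notin I$), and that every $\mathcal P_{sj}$ is nonempty. **The algorithm (UB&DD).** It keeps a queue of tree nodes (each with an integer box for $(x_k)_{k\in I}$ and a list of cuts on $x$), finite sets of Benders cuts $\theta_{sj}\ge d_{sj}(x;\psi,\gamma)$ from basic points of $\mathcal P_{sj}$ and $0\ge d_{sj}(x;\psi,\gamma)$ from basic rays of $\mathcal P_{sj}$, restricted arc sets $A'_{sj}\subseteq A_{sj}$, an upper bound $UB$, and a pool of first-stage solutions.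 A point (ray) is *basic* if it is determined (up to a factor) by its tight constraints and its vanishing coordinates; extreme points and extreme rays are basic. It starts with a root node whose box contains all $x$ with $Ax\ge b$, at least one optimality cut for each $(s,j)$, any $A'_{sj}$, $UB=\infty$ and an empty pool. While the queue is nonempty, it takes any node and solves the linear master relaxation there (minimize $c^\top x+\sum_{s,j}\pi_s\theta_{sj}$ subject to $Ax\ge b$, the box, the node's cuts and the Benders cuts). 1. If it is infeasible or has value at least $UB$, the node is pruned. Otherwise let $(\hat x,\hat\theta)$ be any optimal solution. 2. If $\hat x$ is fractional (some $\hat x_k\notin\mathbb Z$ with $k\in I$), then, optionally after step 3, either a violated inequality that is valid for the mixed-integer points of the node is added (at most $R$ rounds per node, $R$ fixed) and the node returns to the queue, or the node is split into $x_k\le\lfloor\hat x_k\rfloor$ and $x_k\ge\lfloor\hat x_k\rfloor+1$ for some $k\in I$ with $\hat x_k\notin\mathbb Z$. 3. (Column generation.) For all $(s,j)$ the relaxation at $\hat x$ restricted to $A'_{sj}$ is solved, giving an optimal primal solution and a basic optimal dual solution, or, if it is infeasible, a basic ray of the restricted dual polyhedron with positive dual objective. While some arc has negative reduced cost (arc costs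 are taken as $0$ for a ray), at least one such arc is added to each $A'_{sj}$ for which there is one, and the restricted relaxations are solved again. When there is none, if one of the resulting Benders cuts is violated by $(\hat x,\hat\theta)$, all of them are added and the node returns to the queue. 4. If $\hat x$ is integral on $I$ and no Benders cut is violated, put $LB(\hat x)=c^\top\hat x+\overline\Phi(\hat x)$. If $LB(\hat x)\ge UB$, the node is pruned. Otherwise $\hat x$ is stored in the pool; a heuristic or exact method may return a feasible $y$ of $\mathrm{SP}(\hat x)$, in which case $UB\gets\min\{UB,\,c^\top \hat x+\sum_{s,j}\pi_s\sum_{a\in A_{sj}} g_ay_a\}$; and, even though $\hat x$ is integral, the node is split into $x_k\le v$ and $x_k\ge v+1$ for some $k\in I$ whose range in the box is not a single integer and some integer $v$ that leaves both parts nonempty. If no such $k$ exists, the node is removed. When the queue is empty, post-processing solves $\mathrm{SP}(\hat x)$ for all $\hat x$ in the pool and returns a pair $(\hat x,y)$ of least total cost, with $\hat x$ in the pool and $y$ feasible for $\mathrm{SP}(\hat x)$. **Theorem.** Whatever choices are made in these steps: the algorithm can be started, each of its steps can be carried out as long as the queue is nonempty or a node is being processed, and it terminates after finitely many steps. If $(\star)$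 has an optimal solution, then upon termination the post-processing has a result, and every result is an optimal solution of $(\star)$. If $(\star)$ is infeasible, then no $\mathrm{SP}(\hat x)$ with $\hat x$ in the pool is feasible. -/

import Mathlib

/-!
A two-stage stochastic mixed-integer program in network form, and the unified
branch-and-double-decomposition algorithm for it, written as a nondeterministic transition system:
every choice that the algorithm leaves open (node selection, the optimal solution that an LP solver
returns, the arcs that pricing returns, the heuristic, the cuts, the branching variable) is a
choice of the successor state.
-/

namespace TwoStage

/-- Data of the program. `S`: scenarios, `J`: blocks, `K`: first-stage variables (the `j`-th block
of first-stage indices is the fibre of `block` over `j`), `M`: first-stage constraints; `N s j`,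
`A s j`, `L s j`: nodes, arcs and side constraints of the network of scenario `s` and block `j`.
Parallel arcs are allowed. -/
structure Program (S J K M : Type*) (N A L : S → J → Type*) [Fintype S] where
  /-- first-stage costs -/
  cost : K → ℝ
  /-- the block to which a first-stage variable belongs -/
  block : K → J
  /-- the first-stage variables that have to be integer; the others are continuous -/
  intIdx : Set K
  /-- first-stage constraint matrix -/
  mat : M → K → ℝ
  /-- first-stage right-hand side -/
  vec : M → ℝ
  /-- scenario probabilities -/
  prob : S → ℝ
  prob_nonneg : ∀ s, 0 ≤ prob s
  prob_sum : ∑ s, prob s = 1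
  /-- coefficients of the first-stage variables in the flow balance at a node -/
  supply : ∀ s j, N s j → K → ℝ
  /-- tail of an arc -/
  src : ∀ s j, A s j → N s j
  /-- head of an arc -/
  tgt : ∀ s j, A s j → N s j
  /-- arc costs -/
  arcCost : ∀ s j, A s j → ℝ
  /-- coefficients of the side constraints -/
  coef : ∀ s j, A s j → L s j → ℝ
  /-- right-hand sides of the side constraints -/
  demand : ∀ s j, L s j → ℝ
  /-- domain of an arc variable, e.g. `{0, 1}`, the natural numbers or `[0, ∞)` -/
  dom : ∀ s j, A s j → Set ℝ
  dom_nonneg : ∀ s j a, dom s j a ⊆ Set.Ici 0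

/-- A dual vector of a second-stage problem: node potentials `ψ` and side-constraint prices `γ`. -/
abbrev DualVec (N L : Type*) := (N → ℝ) × (L → ℝ)

/-- A node of the branch-and-cut tree: an integer box for the integer variables, the cuts
`∑ k, α k * x k ≥ β` added at the node or at its ancestors, and the number of further rounds of
cuts allowed at the node. The box is only used at the integer indices. -/
structure Node (K : Type*) where
  /-- lower bounds -/
  lo : K → ℤ
  /-- upper bounds -/
  hi : K → ℤ
  /-- cuts on the first-stage variables -/
  cuts : List ((K → ℝ) × ℝ)
  /-- remaining rounds of cuts -/
  rounds : ℕ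

/-- Where the algorithm stands: about to test the queue and to choose a node; in the column
generation loop for a solution `(x, θ)` of the master relaxation at a node; or about to cut or
branch at a node whose solution `x` is fractional. -/
inductive Phase (S J K : Type*) where
  | select
  | sub (n : Node K) (x : K → ℝ) (θ : S → J → ℝ)
  | frac (n : Node K) (x : K → ℝ)

/-- State of the algorithm. -/
structure State (S J K : Type*) (N A L : S → J → Type*) where
  /-- open nodes, other than the one held by the phase -/
  queue : Multiset (Node K)
  /-- current phase -/
  phase : Phase S J K
  /-- dual points that give the current Benders optimality cuts -/
  optCuts : ∀ s j, Set (DualVec (N s j) (L s j))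
  /-- dual rays that give the current Benders feasibility cuts -/
  feasCuts : ∀ s j, Set (DualVec (N s j) (L s j))
  /-- restricted arc sets -/
  arcs : ∀ s j, Set (A s j)
  /-- global upper bound -/
  ub : WithTop ℝ
  /-- stored first-stage solutions -/
  pool : List (K → ℝ)

/-- The algorithm stops when a node is to be chosen and the queue is empty. -/
def State.Terminal {S J K : Type*} {N A L : S → J → Type*} (st : State S J K N A L) : Prop :=
  st.phase = .select ∧ st.queue = 0

/-- Answer of the LP solver on a restricted second-stage relaxation: a primal and a dual optimal
solution, or a dual ray that proves infeasibility. -/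
inductive SubResult (N A L : Type*) where
  | solved (y : A → ℝ) (w : DualVec N L)
  | infeasible (r : DualVec N L)

namespace Program

variable {S J K M : Type*} {N A L : S → J → Type*}
  [Fintype S] [Fintype J] [Fintype K] [Fintype M]
  [∀ s j, Fintype (N s j)] [∀ s j, Fintype (A s j)] [∀ s j, Fintype (L s j)]
  (P : Program S J K M N A L)

/-! ### The program -/

/-- The first-stage polyhedron, without integrality. -/
def firstStage : Set (K → ℝ) := {x | ∀ i, P.vec i ≤ ∑ k, P.mat i k * x k}

/-- First-stage integrality. -/
def Integral (x : K → ℝ) : Prop := ∀ k ∈ P.intIdx, ∃ m : ℤ, x k = m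

open scoped Classical in
/-- Right-hand side of the flow balance at a node, for the first-stage solution `x`. -/
noncomputable def rhs (s : S) (j : J) (x : K → ℝ) (n : N s j) : ℝ :=
  ∑ k with P.block k = j, P.supply s j n k * x k

open scoped Classical in
/-- Outflow minus inflow at a node. -/
noncomputable def netFlow (s : S) (j : J) (y : A s j → ℝ) (n : N s j) : ℝ :=
  (∑ a with P.src s j a = n, y a) - ∑ a with P.tgt s j a = n, y a

/-- Second-stage cost of one scenario and block. -/
noncomputable def flowCost (s : S) (j : J) (y : A s j → ℝ) : ℝ := ∑ a, P.arcCost s j a * y a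

/-- Feasible set of the second-stage relaxation restricted to the arcs in `B` (arcs outside `B`
carry no flow); `B = Set.univ` gives the full relaxation. -/
def relaxed (s : S) (j : J) (B : Set (A s j)) (x : K → ℝ) : Set (A s j → ℝ) :=
  {y | (∀ a, 0 ≤ y a) ∧ (∀ a ∉ B, y a = 0) ∧
    (∀ n, P.netFlow s j y n = P.rhs s j x n) ∧
    ∀ l, P.demand s j l ≤ ∑ a, P.coef s j a l * y a}

/-- `y` is feasible for the mixed-integer second-stage problem of `x`. -/
def Recourse (x : K → ℝ) (y : ∀ s j, A s j → ℝ) : Prop :=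
  ∀ s j, y s j ∈ P.relaxed s j Set.univ x ∧ ∀ a, y s j a ∈ P.dom s j a

/-- First-stage cost plus expected second-stage cost. -/
noncomputable def total (x : K → ℝ) (y : ∀ s j, A s j → ℝ) : ℝ :=
  ∑ k, P.cost k * x k + ∑ s, ∑ j, P.prob s * P.flowCost s j (y s j)

/-- Feasible solutions of the two-stage mixed-integer program. -/
def Feasible (x : K → ℝ) (y : ∀ s j, A s j → ℝ) : Prop :=
  x ∈ P.firstStage ∧ P.Integral x ∧ P.Recourse x y

/-- Optimal solutions of the two-stage mixed-integer program. -/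
def Optimal (x : K → ℝ) (y : ∀ s j, A s j → ℝ) : Prop :=
  P.Feasible x y ∧ ∀ x' y', P.Feasible x' y' → P.total x y ≤ P.total x' y'

/-! ### Duality for the second-stage relaxation -/

/-- Value of a dual vector at an arc: the left-hand side of the dual constraint of the arc. -/
noncomputable def arcVal (s : S) (j : J) (w : DualVec (N s j) (L s j)) (a : A s j) : ℝ :=
  w.1 (P.src s j a) - w.1 (P.tgt s j a) + ∑ l, w.2 l * P.coef s j a l

/-- Dual objective, as a function of the first-stage solution; the Benders cuts of `w` are
`θ s j ≥ dualObj s j x w` and, for a ray, `0 ≥ dualObj s j x w`. -/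
noncomputable def dualObj (s : S) (j : J) (x : K → ℝ) (w : DualVec (N s j) (L s j)) : ℝ :=
  ∑ n, P.rhs s j x n * w.1 n + ∑ l, P.demand s j l * w.2 l

/-- The dual polyhedron with the constraints of the arcs in `B`. -/
def dualPoly (s : S) (j : J) (B : Set (A s j)) : Set (DualVec (N s j) (L s j)) :=
  {w | (∀ l, 0 ≤ w.2 l) ∧ ∀ a ∈ B, P.arcVal s j w a ≤ P.arcCost s j a}

/-- The recession cone of the dual polyhedron with the constraints of the arcs in `B`. -/
def dualCone (s : S) (j : J) (B : Set (A s j)) : Set (DualVec (N s j) (L s j)) :=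
  {w | (∀ l, 0 ≤ w.2 l) ∧ ∀ a ∈ B, P.arcVal s j w a ≤ 0}

/-- Basic points of the dual polyhedron: those that are determined by their tight constraints
together with their vanishing coordinates. Every extreme point is basic. (A dual polyhedron has no
extreme point when it contains a line, which it does as soon as the network has a node, because a
constant can be added to the potentials of a connected component; an LP solver returns a basic
point in all cases.) -/
def BasicPoint (s : S) (j : J) (B : Set (A s j)) (w : DualVec (N s j) (L s j)) : Prop :=
  w ∈ P.dualPoly s j B ∧
    ∀ w' : DualVec (N s j) (L s j),
      (∀ n, w.1 n = 0 → w'.1 n = 0) → (∀ l, w.2 l = 0 → w'.2 l = 0) →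
      (∀ a ∈ B, P.arcVal s j w a = P.arcCost s j a → P.arcVal s j w' a = P.arcCost s j a) →
      w' = w

/-- Basic rays of the dual polyhedron: those that are determined up to a factor by their tight
constraints together with their vanishing coordinates. Every extreme ray is basic. -/
def BasicRay (s : S) (j : J) (B : Set (A s j)) (r : DualVec (N s j) (L s j)) : Prop :=
  r ∈ P.dualCone s j B ∧ r ≠ 0 ∧
    ∀ r' : DualVec (N s j) (L s j),
      (∀ n, r.1 n = 0 → r'.1 n = 0) → (∀ l, r.2 l = 0 → r'.2 l = 0) →
      (∀ a ∈ B, P.arcVal s j r a = 0 → P.arcVal s j r' a = 0) →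
      ∃ t : ℝ, r' = t • r

/-! ### Column generation -/

/-- The answer `res` is correct for the relaxation at `x` restricted to the arcs in `B`. -/
def Solves (s : S) (j : J) (B : Set (A s j)) (x : K → ℝ) :
    SubResult (N s j) (A s j) (L s j) → Prop
  | .solved y w =>
      (y ∈ P.relaxed s j B x ∧
        ∀ y' ∈ P.relaxed s j B x, P.flowCost s j y ≤ P.flowCost s j y') ∧
      (P.BasicPoint s j B w ∧
        ∀ w' ∈ P.dualPoly s j B, P.dualObj s j x w' ≤ P.dualObj s j x w)
  | .infeasible r =>
      P.relaxed s j B x = ∅ ∧ P.BasicRay s j B r ∧ 0 < P.dualObj s j x r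

/-- Reduced cost of an arc (for a ray, the arc cost is replaced by zero). -/
noncomputable def reducedCost (s : S) (j : J) (a : A s j) :
    SubResult (N s j) (A s j) (L s j) → ℝ
  | .solved _ w => P.arcCost s j a - P.arcVal s j w a
  | .infeasible r => 0 - P.arcVal s j r a

/-- The Benders cut of the answer is violated at `(x, θ)`. -/
def Violated (s : S) (j : J) (x : K → ℝ) (θ : ℝ) :
    SubResult (N s j) (A s j) (L s j) → Prop
  | .solved _ w => θ < P.dualObj s j x w
  | .infeasible r => 0 < P.dualObj s j x r

/-! ### The master relaxation and the tree -/

/-- First-stage points in the linear region of a tree node. -/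
def region (n : Node K) : Set (K → ℝ) :=
  {x | x ∈ P.firstStage ∧ (∀ k ∈ P.intIdx, (n.lo k : ℝ) ≤ x k ∧ x k ≤ n.hi k) ∧
    ∀ c ∈ n.cuts, c.2 ≤ ∑ k, c.1 k * x k}

/-- `(x, θ)` is feasible for the master relaxation at node `n` with the cuts of `st`. -/
def MasterFeasible (st : State S J K N A L) (n : Node K) (x : K → ℝ) (θ : S → J → ℝ) : Prop :=
  x ∈ P.region n ∧
    (∀ s j, ∀ w ∈ st.optCuts s j, P.dualObj s j x w ≤ θ s j) ∧
    ∀ s j, ∀ r ∈ st.feasCuts s j, P.dualObj s j x r ≤ 0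

/-- Objective of the master problem. -/
noncomputable def masterObj (x : K → ℝ) (θ : S → J → ℝ) : ℝ :=
  ∑ k, P.cost k * x k + ∑ s, ∑ j, P.prob s * θ s j

/-- `(x, θ)` is optimal for the master relaxation at node `n` with the cuts of `st`. -/
def MasterOptimal (st : State S J K N A L) (n : Node K) (x : K → ℝ) (θ : S → J → ℝ) : Prop :=
  P.MasterFeasible st n x θ ∧
    ∀ x' θ', P.MasterFeasible st n x' θ' → P.masterObj x θ ≤ P.masterObj x' θ'

/-- The cut `c` holds at all mixed-integer first-stage solutions of node `n`. -/
def ValidCut (n : Node K) (c : (K → ℝ) × ℝ) : Prop :=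
  ∀ x ∈ P.region n, P.Integral x → c.2 ≤ ∑ k, c.1 k * x k

open scoped Classical in
/-- The two children `x k ≤ v` and `x k ≥ v + 1` of a node, with `R` rounds of cuts each. -/
noncomputable def children (R : ℕ) (n : Node K) (k : K) (v : ℤ) : Multiset (Node K) :=
  {{ n with hi := Function.update n.hi k v, rounds := R },
   { n with lo := Function.update n.lo k (v + 1), rounds := R }}

/-- What replaces a node after an integral solution has been stored: the children of a split of the
range of any integer variable that is not yet fixed; nothing if all of them are fixed. -/
def Expansion (R : ℕ) (n : Node K) (q : Multiset (Node K)) : Prop :=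
  ((∀ k ∈ P.intIdx, n.hi k ≤ n.lo k) ∧ q = 0) ∨
    ∃ k ∈ P.intIdx, ∃ v : ℤ, n.lo k ≤ v ∧ v < n.hi k ∧ q = children R n k v

/-- The upper bound after the heuristic for the mixed-integer second-stage problem of `x`: the
heuristic finds nothing, or some feasible `y`. (An exact solver, and the restricted problem on the
generated arcs with integrality restored, are instances.) -/
def NewBound (u : WithTop ℝ) (x : K → ℝ) (u' : WithTop ℝ) : Prop :=
  u' = u ∨ ∃ y, P.Recourse x y ∧ u' = min u (P.total x y : WithTop ℝ)

/-- Initial states: the root node with any integer box implied by the first-stage constraints; at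
least one optimality cut for each scenario and block, so that the master problem is bounded;
any restricted arc sets; infinite upper bound and empty pool. -/
def Init (R : ℕ) (st : State S J K N A L) : Prop :=
  (∃ lo hi : K → ℤ,
    (∀ x ∈ P.firstStage, ∀ k ∈ P.intIdx, (lo k : ℝ) ≤ x k ∧ x k ≤ hi k) ∧
    st.queue = {⟨lo, hi, [], R⟩}) ∧
  st.phase = .select ∧
  (∀ s j, (st.optCuts s j).Nonempty ∧ ∀ w ∈ st.optCuts s j, P.BasicPoint s j Set.univ w) ∧
  (∀ s j, ∀ r ∈ st.feasCuts s j, P.BasicRay s j Set.univ r) ∧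
  st.ub = ⊤ ∧ st.pool = []

/-- One step of the algorithm; `R` bounds the rounds of mixed-integer cuts per tree node. -/
inductive Step (R : ℕ) : State S J K N A L → State S J K N A L → Prop
  /-- Choose a node; its master relaxation is infeasible: prune. -/
  | pruneInfeasible (st : State S J K N A L) (n : Node K) (q : Multiset (Node K))
      (hphase : st.phase = .select) (hq : st.queue = n ::ₘ q)
      (hinf : ∀ x θ, ¬ P.MasterFeasible st n x θ) :
      Step R st { st with queue := q }
  /-- Choose a node; the value of its master relaxation is at least the upper bound: prune. -/
  | pruneBound (st : State S J K N A L) (n : Node K) (q : Multiset (Node K))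
      (x : K → ℝ) (θ : S → J → ℝ)
      (hphase : st.phase = .select) (hq : st.queue = n ::ₘ q)
      (hopt : P.MasterOptimal st n x θ) (hub : st.ub ≤ (P.masterObj x θ : WithTop ℝ)) :
      Step R st { st with queue := q }
  /-- Choose a node; its solution is kept and the Benders subproblem is solved at it. This is
  what happens to integral solutions, and it is optional for fractional ones. -/
  | enterSub (st : State S J K N A L) (n : Node K) (q : Multiset (Node K))
      (x : K → ℝ) (θ : S → J → ℝ)
      (hphase : st.phase = .select) (hq : st.queue = n ::ₘ q)
      (hopt : P.MasterOptimal st n x θ) (hub : (P.masterObj x θ : WithTop ℝ) < st.ub) :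
      Step R st { st with queue := q, phase := .sub n x θ }
  /-- Choose a node; its solution is fractional: cut or branch. -/
  | enterFrac (st : State S J K N A L) (n : Node K) (q : Multiset (Node K))
      (x : K → ℝ) (θ : S → J → ℝ)
      (hphase : st.phase = .select) (hq : st.queue = n ::ₘ q)
      (hopt : P.MasterOptimal st n x θ) (hub : (P.masterObj x θ : WithTop ℝ) < st.ub)
      (hfrac : ¬ P.Integral x) :
      Step R st { st with queue := q, phase := .frac n x }
  /-- Column generation: solve the restricted relaxations; some reduced cost is negative; add, for
  each scenario and block with arcs of negative reduced cost, at least one such arc. -/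
  | addArcs (st : State S J K N A L) (n : Node K) (x : K → ℝ) (θ : S → J → ℝ)
      (res : ∀ s j, SubResult (N s j) (A s j) (L s j)) (new : ∀ s j, Set (A s j))
      (hphase : st.phase = .sub n x θ)
      (hres : ∀ s j, P.Solves s j (st.arcs s j) x (res s j))
      (hneg : ∃ s j a, P.reducedCost s j a (res s j) < 0)
      (hnew : ∀ s j, ∀ a ∈ new s j, P.reducedCost s j a (res s j) < 0)
      (hadd : ∀ s j, (∃ a, P.reducedCost s j a (res s j) < 0) → (new s j).Nonempty) :
      Step R st { st with arcs := fun s j => st.arcs s j ∪ new s j }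
  /-- All reduced costs are nonnegative and a Benders cut is violated: add an optimality cut for
  each solved pair of scenario and block and a feasibility cut for each other one; the node goes
  back to the queue. -/
  | addCuts (st : State S J K N A L) (n : Node K) (x : K → ℝ) (θ : S → J → ℝ)
      (res : ∀ s j, SubResult (N s j) (A s j) (L s j))
      (hphase : st.phase = .sub n x θ)
      (hres : ∀ s j, P.Solves s j (st.arcs s j) x (res s j))
      (hprice : ∀ s j a, 0 ≤ P.reducedCost s j a (res s j))
      (hviol : ∃ s j, P.Violated s j x (θ s j) (res s j)) :
      Step R st { st with
        queue := n ::ₘ st.queue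
        phase := .select
        optCuts := fun s j => st.optCuts s j ∪ {w | ∃ y, res s j = .solved y w}
        feasCuts := fun s j => st.feasCuts s j ∪ {r | res s j = .infeasible r} }
  /-- No Benders cut is violated at a fractional solution: cut or branch. -/
  | separated (st : State S J K N A L) (n : Node K) (x : K → ℝ) (θ : S → J → ℝ)
      (res : ∀ s j, SubResult (N s j) (A s j) (L s j))
      (hphase : st.phase = .sub n x θ)
      (hres : ∀ s j, P.Solves s j (st.arcs s j) x (res s j))
      (hprice : ∀ s j a, 0 ≤ P.reducedCost s j a (res s j))
      (hviol : ∀ s j, ¬ P.Violated s j x (θ s j) (res s j))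
      (hfrac : ¬ P.Integral x) :
      Step R st { st with phase := .frac n x }
  /-- No Benders cut is violated at an integral solution, and the lower bound given by that
  solution and its second-stage relaxation is at least the upper bound: prune. -/
  | pruneLower (st : State S J K N A L) (n : Node K) (x : K → ℝ) (θ : S → J → ℝ)
      (y : ∀ s j, A s j → ℝ) (w : ∀ s j, DualVec (N s j) (L s j))
      (hphase : st.phase = .sub n x θ)
      (hres : ∀ s j, P.Solves s j (st.arcs s j) x (.solved (y s j) (w s j)))
      (hprice : ∀ s j a, 0 ≤ P.reducedCost s j a (.solved (y s j) (w s j)))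
      (hviol : ∀ s j, ¬ P.Violated s j x (θ s j) (.solved (y s j) (w s j)))
      (hint : P.Integral x) (hub : st.ub ≤ (P.total x y : WithTop ℝ)) :
      Step R st { st with phase := .select }
  /-- No Benders cut is violated at an integral solution, and the lower bound is below the upper
  bound: store the solution, update the upper bound, and branch (no pruning by integrality). -/
  | store (st : State S J K N A L) (n : Node K) (x : K → ℝ) (θ : S → J → ℝ)
      (y : ∀ s j, A s j → ℝ) (w : ∀ s j, DualVec (N s j) (L s j))
      (u : WithTop ℝ) (q : Multiset (Node K))
      (hphase : st.phase = .sub n x θ)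
      (hres : ∀ s j, P.Solves s j (st.arcs s j) x (.solved (y s j) (w s j)))
      (hprice : ∀ s j a, 0 ≤ P.reducedCost s j a (.solved (y s j) (w s j)))
      (hviol : ∀ s j, ¬ P.Violated s j x (θ s j) (.solved (y s j) (w s j)))
      (hint : P.Integral x) (hub : (P.total x y : WithTop ℝ) < st.ub)
      (hu : P.NewBound st.ub x u) (hexp : P.Expansion R n q) :
      Step R st { st with
        queue := q + st.queue, phase := .select, ub := u, pool := x :: st.pool }
  /-- Fractional solution: add a violated valid cut to the node, which goes back to the queue. -/
  | mioCut (st : State S J K N A L) (n : Node K) (x : K → ℝ) (c : (K → ℝ) × ℝ) (m : ℕ)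
      (hphase : st.phase = .frac n x) (hround : n.rounds = m + 1)
      (hvalid : P.ValidCut n c) (hcut : ∑ k, c.1 k * x k < c.2) :
      Step R st { st with
        queue := { n with cuts := c :: n.cuts, rounds := m } ::ₘ st.queue, phase := .select }
  /-- Fractional solution: branch on a fractional integer variable. -/
  | branch (st : State S J K N A L) (n : Node K) (x : K → ℝ) (k : K)
      (hphase : st.phase = .frac n x) (hk : k ∈ P.intIdx) (hfrac : ∀ m : ℤ, x k ≠ m) :
      Step R st { st with queue := children R n k ⌊x k⌋ + st.queue, phase := .select }

/-- States that the algorithm reaches from an initial state. -/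
def Reachable (R : ℕ) (st : State S J K N A L) : Prop :=
  ∃ st₀, P.Init R st₀ ∧ Relation.ReflTransGen (P.Step R) st₀ st

/-- Post-processing: `(x, y)` is a best completion of a stored first-stage solution by a feasible
solution of its mixed-integer second-stage problem. -/
def Output (st : State S J K N A L) (x : K → ℝ) (y : ∀ s j, A s j → ℝ) : Prop :=
  x ∈ st.pool ∧ P.Recourse x y ∧
    ∀ x' ∈ st.pool, ∀ y', P.Recourse x' y' → P.total x y ≤ P.total x' y'

end Program

end TwoStage

/-! ### Linear inequalities over the reals -/

namespace LinIneq

variable {V ι κ : Type*} [AddCommGroup V] [Module ℝ V]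

/-! Correctness rests on one invariant (`Invariant.covered`): every feasible `(x, y)` of the program
either has `x` in the region of an open node or costs at least as much as some completion of a
pooled solution. Splits and valid cuts keep all integral points. Benders cuts hold for the
relaxation by weak duality, so the master value bounds a node from below. When no cut is violated,
strong duality puts the value of the relaxation at the master solution below the master value. Hence
a node pruned by either bound contains nothing cheaper than the upper bound, which a pooled solution
attains. The critical case is the removal of a node whose integer variables are all fixed
(`poolBound_of_fixed`): the second stage sees only those variables, so all points of the node have
the same completions and the stored master optimum has the least first-stage cost. Once no node is
open, the pool therefore matches every feasible solution.

Termination uses the lexicographic measure (Benders cuts left, arcs left, weight of the open nodes,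
phase). Basic points, and basic rays up to a positive factor, are determined by finitely many sign
and tightness patterns (`BasicPoint.eq_of_signature`, `BasicRay.exists_pos_smul_of_signature`), and
a violated cut has a new pattern. Arcs of negative reduced cost are new. The weight is exponential
in the box size, so two children together weigh less than their parent.

Progress needs the LPs to have answers of the required form. Farkas' lemma yields attained optima
with multipliers (`exists_max`), a point with as many tight constraints and vanishing coordinates as
possible is basic (`exists_basic`), and the master attains its minimum by compactness
(`exists_masterOptimal`). -/

/-- Farkas' lemma for finitely many linear functionals. -/
theorem farkas_finset [DecidableEq ι] (t : Finset ι) (f : ι → V →ₗ[ℝ] ℝ) (g : V →ₗ[ℝ] ℝ)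
    (h : ∀ v, (∀ i ∈ t, f i v ≤ 0) → g v ≤ 0) :
    ∃ c : ι → ℝ, (∀ i, 0 ≤ c i) ∧ ∀ v, g v = ∑ i ∈ t, c i * f i v := by
  induction t using Finset.induction_on generalizing f g with
  | empty =>
    refine ⟨0, fun _ => le_rfl, fun v => ?_⟩
    have h1 := h v (by simp)
    have h2 := h (-v) (by simp)
    rw [map_neg] at h2
    simp only [Finset.sum_empty]
    linarith
  | insert a t hat ih =>
    by_cases hg : ∀ v, (∀ i ∈ t, f i v ≤ 0) → g v ≤ 0
    · obtain ⟨c, hc, hcg⟩ := ih f g hg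
      refine ⟨Function.update c a 0, fun i => ?_, fun v => ?_⟩
      · by_cases hi : i = a
        · simp [hi]
        · simp [hi, hc i]
      · rw [Finset.sum_insert hat, hcg v]
        simp only [Function.update_self, zero_mul, zero_add]
        refine Finset.sum_congr rfl fun i hi => ?_
        rw [Function.update_of_ne (ne_of_mem_of_not_mem hi hat)]
    · push Not at hg
      obtain ⟨u, hu, hgu⟩ := hg
      have hau : 0 < f a u := by
        by_contra hle
        refine absurd (h u fun i hi => ?_) (not_le.2 hgu)
        rcases Finset.mem_insert.1 hi with rfl | hi
        · exact not_lt.1 hle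
        · exact hu i hi
      -- The induction hypothesis is applied after composing every functional with the projection
      -- onto the kernel of `f a` along `u`.
      obtain ⟨c, hc, hcg⟩ := ih (fun i => f i - (f i u / f a u) • f a) (g - (g u / f a u) • f a)
        (fun v hv => by
          have := h (v - (f a v / f a u) • u) (fun i hi => by
            rcases Finset.mem_insert.1 hi with rfl | hi
            · simp [hau.ne']
            · have := hv i hi
              simp only [LinearMap.sub_apply, LinearMap.smul_apply, smul_eq_mul, map_sub,
                map_smul] at this ⊢
              calc _ = f i v - f i u / f a u * f a v := by ring
                _ ≤ 0 := this)
          simp only [LinearMap.sub_apply, LinearMap.smul_apply, smul_eq_mul, map_sub,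
            map_smul] at this ⊢
          calc _ = g v - f a v / f a u * g u := by ring
            _ ≤ 0 := this)
      have hsum : ∑ i ∈ t, c i * f i u ≤ 0 :=
        Finset.sum_nonpos fun i hi => mul_nonpos_of_nonneg_of_nonpos (hc i) (hu i hi)
      -- The multiplier of `f a` is forced by evaluating the identity at `u`; it is nonnegative
      -- because `g u` is positive and the sum is not.
      refine ⟨Function.update c a ((g u - ∑ i ∈ t, c i * f i u) / f a u), fun i => ?_,
        fun v => ?_⟩
      · by_cases hi : i = a
        · subst hi
          rw [Function.update_self]
          exact div_nonneg (by linarith) hau.le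
        · simp [hi, hc i]
      · rw [Finset.sum_insert hat, Function.update_self]
        have hcv := hcg v
        simp only [LinearMap.sub_apply, LinearMap.smul_apply, smul_eq_mul, mul_sub,
          Finset.sum_sub_distrib] at hcv
        have h1 : ∑ i ∈ t, Function.update c a ((g u - ∑ i ∈ t, c i * f i u) / f a u) i * f i v
            = ∑ i ∈ t, c i * f i v := Finset.sum_congr rfl fun i hi => by
          rw [Function.update_of_ne (ne_of_mem_of_not_mem hi hat)]
        have h2 : ∑ i ∈ t, c i * (f i u / f a u * f a v)
            = (∑ i ∈ t, c i * f i u) / f a u * f a v := by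
          rw [Finset.sum_div, Finset.sum_mul]
          exact Finset.sum_congr rfl fun i _ => by ring
        rw [h1]
        rw [h2] at hcv
        have h3 : (g u - ∑ i ∈ t, c i * f i u) / f a u * f a v
          = g u / f a u * f a v - (∑ i ∈ t, c i * f i u) / f a u * f a v := by ring
        rw [h3]
        linarith

theorem farkas [Fintype ι] (f : ι → V →ₗ[ℝ] ℝ) (g : V →ₗ[ℝ] ℝ)
    (h : ∀ v, (∀ i, f i v ≤ 0) → g v ≤ 0) :
    ∃ c : ι → ℝ, (∀ i, 0 ≤ c i) ∧ ∀ v, g v = ∑ i, c i * f i v := by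
  classical
  exact farkas_finset Finset.univ f g (by simpa using h)

/-- An infeasible finite system of linear inequalities has an infeasibility certificate. -/
theorem exists_certificate [Fintype ι] (f : ι → V →ₗ[ℝ] ℝ) (b : ι → ℝ)
    (h : ¬ ∃ v, ∀ i, f i v ≤ b i) :
    ∃ c : ι → ℝ, (∀ i, 0 ≤ c i) ∧ (∀ v, ∑ i, c i * f i v = 0) ∧ ∑ i, c i * b i < 0 := by
  -- Homogenisation: infeasibility says that `f i v ≤ t * b i` and `0 ≤ t` force `t ≤ 0`. The
  -- resulting identity is then read off at `(v, 0)` and `(0, 1)`.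
  obtain ⟨c, hc, hcg⟩ := farkas (V := V × ℝ) (ι := Option ι)
    (fun o => o.elim (-LinearMap.snd ℝ V ℝ)
      (fun i => (f i).comp (LinearMap.fst ℝ V ℝ) - b i • LinearMap.snd ℝ V ℝ))
    (LinearMap.snd ℝ V ℝ) (by
      rintro ⟨v, t⟩ hv
      by_contra ht
      simp only [LinearMap.snd_apply, not_le] at ht
      refine h ⟨t⁻¹ • v, fun i => ?_⟩
      have := hv (some i)
      simp only [Option.elim_some, LinearMap.sub_apply, LinearMap.comp_apply,
        LinearMap.fst_apply, LinearMap.smul_apply, LinearMap.snd_apply, smul_eq_mul] at this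
      rw [map_smul, smul_eq_mul, inv_mul_le_iff₀ ht]
      linarith)
  refine ⟨fun i => c (some i), fun i => hc _, fun v => ?_, ?_⟩
  · have := hcg (v, 0)
    simpa [Fintype.sum_option] using this.symm
  · have := hcg (0, 1)
    simp only [Fintype.sum_option, Option.elim_some, Option.elim_none, LinearMap.sub_apply,
      LinearMap.neg_apply, LinearMap.comp_apply, LinearMap.fst_apply, LinearMap.smul_apply,
      LinearMap.snd_apply, smul_eq_mul, map_zero, mul_one, zero_sub, mul_neg,
      Finset.sum_neg_distrib] at this
    linarith [hc none]

/-- A linear functional without ascent direction attains its maximum over a nonempty polyhedron,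
and an optimal solution of the dual program certifies it. -/
theorem exists_max [Fintype ι] (f : ι → V →ₗ[ℝ] ℝ) (b : ι → ℝ) (d : V →ₗ[ℝ] ℝ)
    (hne : ∃ v, ∀ i, f i v ≤ b i) (hd : ∀ v, (∀ i, f i v ≤ 0) → d v ≤ 0) :
    ∃ v, (∀ i, f i v ≤ b i) ∧ ∃ c : ι → ℝ, (∀ i, 0 ≤ c i) ∧ (∀ v, d v = ∑ i, c i * f i v) ∧
      d v = ∑ i, c i * b i := by
  obtain ⟨c₀, hc₀, hd₀⟩ := farkas f d hd
  set Q : Set V := {v | ∀ i, f i v ≤ b i} with hQ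
  have weak : ∀ c : ι → ℝ, (∀ i, 0 ≤ c i) → ∀ v ∈ Q, ∑ i, c i * f i v ≤ ∑ i, c i * b i :=
    fun c hc v hv => Finset.sum_le_sum fun i _ => mul_le_mul_of_nonneg_left (hv i) (hc i)
  have hbdd : BddAbove (d '' Q) := by
    refine ⟨∑ i, c₀ i * b i, ?_⟩
    rintro _ ⟨v, hv, rfl⟩
    rw [hd₀]
    exact weak c₀ hc₀ v hv
  have hne' : (d '' Q).Nonempty := by
    obtain ⟨v, hv⟩ := hne
    exact ⟨d v, v, hv, rfl⟩
  set z := sSup (d '' Q) with hz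
  have hle : ∀ v ∈ Q, d v ≤ z := fun v hv => le_csSup hbdd ⟨v, hv, rfl⟩
  -- If the supremum were not attained, a certificate against `d v ≥ z` on `Q` would give an upper
  -- bound for `d` strictly below `z`.
  have hatt : ∃ v ∈ Q, z ≤ d v := by
    by_contra hno
    obtain ⟨c, hc, hc0, hcb⟩ := exists_certificate (ι := Option ι)
      (fun o => o.elim (-d) f) (fun o => o.elim (-z) b) (by
        rintro ⟨v, hv⟩
        refine hno ⟨v, fun i => hv (some i), ?_⟩
        have := hv none
        simpa using this)
    simp only [Fintype.sum_option, Option.elim_some, Option.elim_none, LinearMap.neg_apply]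
      at hc0 hcb
    -- With multiplier zero on the objective row the certificate would refute `Q` itself, which is
    -- nonempty.
    have hpos : 0 < c none := by
      refine lt_of_le_of_ne (hc none) fun h0 => ?_
      obtain ⟨v, hv⟩ := hne
      have h1 := weak (fun i => c (some i)) (fun i => hc _) v hv
      have h2 := hc0 v
      rw [← h0] at h2 hcb
      linarith
    have hub : z ≤ (∑ i, c (some i) * b i) / c none := by
      refine csSup_le hne' ?_
      rintro _ ⟨v, hv, rfl⟩
      rw [le_div_iff₀ hpos]
      have h1 := weak (fun i => c (some i)) (fun i => hc _) v hv
      have h2 := hc0 v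
      linarith
    rw [le_div_iff₀ hpos] at hub
    linarith
  obtain ⟨v, hv, hzv⟩ := hatt
  have hvz : d v = z := le_antisymm (hle v hv) hzv
  -- complementary slackness: only the tight constraints are used
  classical
  obtain ⟨c, hc, hcd⟩ := farkas_finset (Finset.univ.filter fun i => f i v = b i) f d (by
    -- A counterexample `u` to the Farkas condition would be an ascent direction along which a short
    -- step from `v` stays in `Q`.
    intro u hu
    by_contra hdu
    rw [not_le] at hdu
    have hsmall : ∃ e : ℝ, 0 < e ∧ ∀ i, f i v ≠ b i → e * f i u ≤ b i - f i v := by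
      have key : ∀ i, ∀ᶠ e : ℝ in nhdsWithin 0 (Set.Ioi 0),
          f i v ≠ b i → e * f i u ≤ b i - f i v := by
        intro i
        by_cases hi : f i v = b i
        · simp [hi]
        · have hlt : 0 < b i - f i v := sub_pos.2 (lt_of_le_of_ne (hv i) hi)
          have ht : Filter.Tendsto (fun e : ℝ => e * f i u) (nhds 0) (nhds 0) := by
            have : Continuous fun e : ℝ => e * f i u := by fun_prop
            simpa using this.tendsto 0
          filter_upwards [nhdsWithin_le_nhds (ht.eventually_lt_const hlt)] with e he _
          exact he.le
      obtain ⟨e, he, hpos⟩ := ((Filter.eventually_all.2 key).and self_mem_nhdsWithin).exists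
      exact ⟨e, hpos, he⟩
    obtain ⟨e, he, hsm⟩ := hsmall
    have hmem : v + e • u ∈ Q := fun i => by
      rw [map_add, map_smul, smul_eq_mul]
      by_cases hi : f i v = b i
      · have := mul_nonpos_of_nonneg_of_nonpos he.le (hu i (by simp [hi]))
        linarith
      · linarith [hsm i hi]
    have := hle _ hmem
    rw [map_add, map_smul, smul_eq_mul] at this
    nlinarith [mul_pos he hdu])
  refine ⟨v, hv, fun i => if f i v = b i then c i else 0, fun i => ?_, fun w => ?_, ?_⟩
  · dsimp only
    split_ifs
    exacts [hc i, le_rfl]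
  · simp only [hcd w, Finset.sum_filter, ite_mul, zero_mul]
  · rw [hcd v, Finset.sum_filter]
    refine Finset.sum_congr rfl fun i _ => ?_
    dsimp only
    split_ifs with hi
    · rw [hi]
    · rw [zero_mul]

/-- A nonempty slice of a polyhedron has a point that is determined by its tight constraints and
its vanishing coordinates. -/
theorem exists_basic [Finite ι] [Finite κ] (f : ι → V →ₗ[ℝ] ℝ) (b : ι → ℝ)
    (g : κ → V →ₗ[ℝ] ℝ) (hg : ∀ v, (∀ m, g m v = 0) → v = 0) (e : V →ₗ[ℝ] ℝ) (z : ℝ)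
    (hne : ∃ v, (∀ i, f i v ≤ b i) ∧ e v = z) :
    ∃ v, (∀ i, f i v ≤ b i) ∧ e v = z ∧ ∀ v', (∀ m, g m v = 0 → g m v' = 0) →
      (∀ i, f i v = b i → f i v' = b i) → e v' = z → v' = v := by
  classical
  have := Fintype.ofFinite ι
  have := Fintype.ofFinite κ
  -- The basic point maximises the number of tight constraints plus vanishing coordinates. If a
  -- second point fitted its pattern, moving along the difference would enlarge the pattern.
  set T : V → Finset (ι ⊕ κ) := fun v =>
    Finset.univ.filter fun o => Sum.elim (fun i => f i v = b i) (fun m => g m v = 0) o with hT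
  obtain ⟨v, ⟨hv, hev⟩, hmax⟩ : ∃ v, ((∀ i, f i v ≤ b i) ∧ e v = z) ∧
      ∀ u, ((∀ i, f i u ≤ b i) ∧ e u = z) → (T u).card ≤ (T v).card := by
    have hbd : ∃ k, ∀ u, ((∀ i, f i u ≤ b i) ∧ e u = z) → (T u).card ≤ k :=
      ⟨Fintype.card (ι ⊕ κ), fun u _ => Finset.card_le_univ _⟩
    obtain ⟨v₀, hv₀⟩ := hne
    set W : Set ℕ := (fun u => (T u).card) '' {u | (∀ i, f i u ≤ b i) ∧ e u = z} with hW
    have hWne : W.Nonempty := ⟨_, v₀, hv₀, rfl⟩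
    have hWb : BddAbove W := by
      obtain ⟨k, hk⟩ := hbd
      exact ⟨k, by rintro _ ⟨u, hu, rfl⟩; exact hk u hu⟩
    obtain ⟨v, hv, hvW⟩ := Nat.sSup_mem hWne hWb
    refine ⟨v, hv, fun u hu => ?_⟩
    change _ ≤ (fun u => (T u).card) v
    rw [hvW]
    exact le_csSup hWb ⟨u, hu, rfl⟩
  refine ⟨v, hv, hev, fun v' hgv hfv hev' => ?_⟩
  by_contra hvv
  set u := v' - v with hu
  have hu0 : u ≠ 0 := sub_ne_zero.2 hvv
  have heu : e u = 0 := by rw [hu, map_sub, hev, hev', sub_self]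
  have hfu : ∀ i, f i v = b i → f i u = 0 := fun i hi => by
    rw [hu, map_sub, hfv i hi, hi, sub_self]
  have hgu : ∀ m, g m v = 0 → g m u = 0 := fun m hm => by
    rw [hu, map_sub, hgv m hm, hm, sub_self]
  -- step lengths at which a further constraint becomes tight or a further coordinate vanishes
  set d : ι ⊕ κ → ℝ := Sum.elim (fun i => f i u) (fun m => g m u) with hd
  set r : ι ⊕ κ → ℝ := Sum.elim (fun i => b i - f i v) (fun m => - g m v) with hr
  have hD : (Finset.univ.filter fun o => d o ≠ 0).Nonempty := by
    by_contra hemp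
    rw [Finset.not_nonempty_iff_eq_empty, Finset.filter_eq_empty_iff] at hemp
    refine hu0 (hg u fun m => ?_)
    simpa [hd] using hemp (Finset.mem_univ (Sum.inr m))
  -- The shortest step in absolute value, in either direction, is taken, so no other constraint is
  -- passed before `o` is reached.
  obtain ⟨o, ho, hmin⟩ := Finset.exists_min_image _ (fun o => |r o / d o|) hD
  simp only [Finset.mem_filter, Finset.mem_univ, true_and] at ho hmin
  set t := r o / d o with ht
  have hfeas : (∀ i, f i (v + t • u) ≤ b i) ∧ e (v + t • u) = z := by
    constructor
    · intro i
      rw [map_add, map_smul, smul_eq_mul]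
      by_cases hi : f i u = 0
      · simpa [hi] using hv i
      · have h1 := hmin (Sum.inl i) (by simpa [hd] using hi)
        change |t| ≤ |(b i - f i v) / f i u| at h1
        rw [abs_div (b i - f i v), le_div_iff₀ (abs_pos.2 hi), ← abs_mul,
          abs_of_nonneg (sub_nonneg.2 (hv i))] at h1
        linarith [le_abs_self (t * f i u)]
    · rw [map_add, map_smul, heu, hev]
      simp
  have hsub : T v ⊆ T (v + t • u) := by
    intro p hp
    simp only [hT, Finset.mem_filter, Finset.mem_univ, true_and] at hp ⊢
    rcases p with i | m
    · simp only [Sum.elim_inl] at hp ⊢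
      simp [hfu i hp, hp]
    · simp only [Sum.elim_inr] at hp ⊢
      simp [hgu m hp, hp]
  have hnew : o ∈ T (v + t • u) ∧ o ∉ T v := by
    simp only [hT, Finset.mem_filter, Finset.mem_univ, true_and]
    have hto : t * d o = r o := div_mul_cancel₀ _ ho
    rcases o with i | m
    · simp only [hd, hr, Sum.elim_inl] at ho hto ⊢
      refine ⟨?_, fun h => ho (hfu i h)⟩
      rw [map_add, map_smul, smul_eq_mul, hto]
      ring
    · simp only [hd, hr, Sum.elim_inr] at ho hto ⊢
      refine ⟨?_, fun h => ho (hgu m h)⟩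
      rw [map_add, map_smul, smul_eq_mul, hto]
      ring
  have hlt : (T v).card < (T (v + t • u)).card :=
    Finset.card_lt_card ((Finset.ssubset_iff_of_subset hsub).2 ⟨o, hnew.1, hnew.2⟩)
  exact absurd (hmax _ hfeas) (not_le.2 hlt)

end LinIneq

/-- The nodes that are not yet done: those in the queue and the one held by the phase. -/
def TwoStage.State.openNodes {S J K : Type*} {N A L : S → J → Type*}
    (st : TwoStage.State S J K N A L) : Multiset (TwoStage.Node K) :=
  match st.phase with
  | .select => st.queue
  | .sub n _ _ => n ::ₘ st.queue
  | .frac n _ => n ::ₘ st.queue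

set_option linter.unusedSectionVars false

namespace TwoStage.Program

variable {S J K M : Type*} {N A L : S → J → Type*}
  [Fintype S] [Fintype J] [Fintype K] [Fintype M]
  [∀ s j, Fintype (N s j)] [∀ s j, Fintype (A s j)] [∀ s j, Fintype (L s j)]
  (P : Program S J K M N A L)

/-! ### Duality for the second-stage relaxation -/

/-- The left-hand side of the dual constraint of an arc as a linear functional. -/
noncomputable def arcValLin (s : S) (j : J) (a : A s j) :
    DualVec (N s j) (L s j) →ₗ[ℝ] ℝ where
  toFun w := P.arcVal s j w a
  map_add' v w := by
    simp only [arcVal, Prod.fst_add, Prod.snd_add, Pi.add_apply, add_mul, Finset.sum_add_distrib]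
    ring
  map_smul' t w := by
    simp only [arcVal, Prod.smul_fst, Prod.smul_snd, Pi.smul_apply, smul_eq_mul, mul_assoc,
      ← Finset.mul_sum, RingHom.id_apply]
    ring

/-- The dual objective as a linear functional. -/
noncomputable def dualObjLin (s : S) (j : J) (x : K → ℝ) :
    DualVec (N s j) (L s j) →ₗ[ℝ] ℝ where
  toFun w := P.dualObj s j x w
  map_add' v w := by
    simp only [dualObj, Prod.fst_add, Prod.snd_add, Pi.add_apply, mul_add, Finset.sum_add_distrib]
    ring
  map_smul' t w := by
    simp only [dualObj, Prod.smul_fst, Prod.smul_snd, Pi.smul_apply, smul_eq_mul, mul_left_comm _ t,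
      ← Finset.mul_sum, RingHom.id_apply]
    ring

theorem arcValLin_apply (s : S) (j : J) (a : A s j) (w : DualVec (N s j) (L s j)) :
    P.arcValLin s j a w = P.arcVal s j w a := rfl

theorem dualObjLin_apply (s : S) (j : J) (x : K → ℝ) (w : DualVec (N s j) (L s j)) :
    P.dualObjLin s j x w = P.dualObj s j x w := rfl

open scoped Classical in
/-- The constraints of the dual polyhedron for the arcs in `B` (left-hand sides). -/
noncomputable def dualLhs (s : S) (j : J) (B : Set (A s j)) :
    L s j ⊕ A s j → DualVec (N s j) (L s j) →ₗ[ℝ] ℝ :=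
  Sum.elim (fun l => -(LinearMap.proj l).comp (LinearMap.snd ℝ (N s j → ℝ) (L s j → ℝ)))
    -- Arcs outside `B` give the trivial constraint `0 ≤ 0`, which keeps the index type independent
    -- of `B`.
    (fun a => if a ∈ B then P.arcValLin s j a else 0)

open scoped Classical in
/-- The constraints of the dual polyhedron for the arcs in `B` (right-hand sides). -/
noncomputable def dualRhs (s : S) (j : J) (B : Set (A s j)) : L s j ⊕ A s j → ℝ :=
  Sum.elim 0 (fun a => if a ∈ B then P.arcCost s j a else 0)

/-- The coordinates of a dual vector. -/
noncomputable def dualCoord (N L : Type*) : N ⊕ L → DualVec N L →ₗ[ℝ] ℝ :=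
  Sum.elim (fun n => (LinearMap.proj n).comp (LinearMap.fst ℝ (N → ℝ) (L → ℝ)))
    (fun l => (LinearMap.proj l).comp (LinearMap.snd ℝ (N → ℝ) (L → ℝ)))

theorem eq_zero_of_dualCoord {N L : Type*} (w : DualVec N L)
    (h : ∀ m, dualCoord N L m w = 0) : w = 0 := by
  ext i
  · exact h (Sum.inl i)
  · exact h (Sum.inr i)

theorem dualLhs_inl (s : S) (j : J) (B : Set (A s j)) (l : L s j)
    (w : DualVec (N s j) (L s j)) : P.dualLhs s j B (Sum.inl l) w = -w.2 l := rfl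

theorem dualLhs_inr (s : S) (j : J) {B : Set (A s j)} {a : A s j} (ha : a ∈ B)
    (w : DualVec (N s j) (L s j)) : P.dualLhs s j B (Sum.inr a) w = P.arcVal s j w a := by
  simp [dualLhs, ha, arcValLin_apply]

theorem dualLhs_inr_of_notMem (s : S) (j : J) {B : Set (A s j)} {a : A s j} (ha : a ∉ B)
    (w : DualVec (N s j) (L s j)) : P.dualLhs s j B (Sum.inr a) w = 0 := by
  simp [dualLhs, ha]

theorem dualRhs_inr (s : S) (j : J) {B : Set (A s j)} {a : A s j} (ha : a ∈ B) :
    P.dualRhs s j B (Sum.inr a) = P.arcCost s j a := by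
  simp [dualRhs, ha]

theorem dualRhs_inr_of_notMem (s : S) (j : J) {B : Set (A s j)} {a : A s j} (ha : a ∉ B) :
    P.dualRhs s j B (Sum.inr a) = 0 := by
  simp [dualRhs, ha]

theorem mem_dualPoly_iff (s : S) (j : J) (B : Set (A s j)) (w : DualVec (N s j) (L s j)) :
    w ∈ P.dualPoly s j B ↔ ∀ i, P.dualLhs s j B i w ≤ P.dualRhs s j B i := by
  rw [Sum.forall]
  refine and_congr (forall_congr' fun l => ?_) (forall_congr' fun a => ?_)
  · rw [dualLhs_inl]
    exact neg_nonpos.symm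
  · by_cases ha : a ∈ B
    · simp [dualLhs_inr P s j ha, dualRhs_inr P s j ha, ha]
    · simp [dualLhs_inr_of_notMem P s j ha, dualRhs_inr_of_notMem P s j ha, ha]

theorem mem_dualCone_iff (s : S) (j : J) (B : Set (A s j)) (w : DualVec (N s j) (L s j)) :
    w ∈ P.dualCone s j B ↔ ∀ i, P.dualLhs s j B i w ≤ 0 := by
  rw [Sum.forall]
  refine and_congr (forall_congr' fun l => ?_) (forall_congr' fun a => ?_)
  · rw [dualLhs_inl]
    exact neg_nonpos.symm
  · by_cases ha : a ∈ B
    · simp [dualLhs_inr P s j ha, ha]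
    · simp [dualLhs_inr_of_notMem P s j ha, ha]

/-- Summation by parts on the network: an arc's flow counts positively at its tail and negatively at
its head. -/
theorem sum_netFlow_mul (s : S) (j : J) (y : A s j → ℝ) (ψ : N s j → ℝ) :
    ∑ n, P.netFlow s j y n * ψ n = ∑ a, y a * (ψ (P.src s j a) - ψ (P.tgt s j a)) := by
  classical
  have key : ∀ e : A s j → N s j, ∑ n, (∑ a with e a = n, y a) * ψ n = ∑ a, y a * ψ (e a) := by
    intro e
    rw [← Finset.sum_fiberwise Finset.univ e]
    refine Finset.sum_congr rfl fun n _ => ?_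
    rw [Finset.sum_mul]
    refine Finset.sum_congr rfl fun a ha => ?_
    rw [(Finset.mem_filter.1 ha).2]
  simp only [netFlow, sub_mul, mul_sub, Finset.sum_sub_distrib]
  rw [← key, ← key]

/-- The dual constraint matrix is the transpose of the primal one. -/
theorem sum_mul_arcVal (s : S) (j : J) (y : A s j → ℝ) (w : DualVec (N s j) (L s j)) :
    ∑ a, y a * P.arcVal s j w a =
      ∑ n, P.netFlow s j y n * w.1 n + ∑ l, (∑ a, P.coef s j a l * y a) * w.2 l := by
  rw [sum_netFlow_mul]
  simp only [arcVal, mul_add, Finset.sum_add_distrib, Finset.mul_sum, Finset.sum_mul]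
  congr 1
  rw [Finset.sum_comm]
  exact Finset.sum_congr rfl fun l _ => Finset.sum_congr rfl fun a _ => by ring

/-- The half of weak duality shared by points and rays: flow balance contributes an equality, and
the side constraints an inequality because the prices are nonnegative. -/
theorem dualObj_le_sum_arcVal (s : S) (j : J) {B : Set (A s j)} {x : K → ℝ} {y : A s j → ℝ}
    (hy : y ∈ P.relaxed s j B x) {w : DualVec (N s j) (L s j)} (hw : ∀ l, 0 ≤ w.2 l) :
    P.dualObj s j x w ≤ ∑ a, y a * P.arcVal s j w a := by
  rw [sum_mul_arcVal, dualObj]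
  refine add_le_add (Finset.sum_congr rfl fun n _ => by rw [hy.2.2.1 n]).le ?_
  exact Finset.sum_le_sum fun l _ => mul_le_mul_of_nonneg_right (hy.2.2.2 l) (hw l)

/-- Weak duality. -/
theorem dualObj_le_flowCost (s : S) (j : J) {B : Set (A s j)} {x : K → ℝ} {y : A s j → ℝ}
    (hy : y ∈ P.relaxed s j B x) {w : DualVec (N s j) (L s j)} (hw : w ∈ P.dualPoly s j B) :
    P.dualObj s j x w ≤ P.flowCost s j y := by
  refine (P.dualObj_le_sum_arcVal s j hy hw.1).trans (Finset.sum_le_sum fun a _ => ?_)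
  by_cases ha : a ∈ B
  · rw [mul_comm]
    exact mul_le_mul_of_nonneg_right (hw.2 a ha) (hy.1 a)
  · simp [hy.2.1 a ha]

/-- Weak duality with arc costs zero. It makes feasibility cuts valid, and makes a ray of positive
objective a proof of infeasibility. -/
theorem dualObj_nonpos (s : S) (j : J) {B : Set (A s j)} {x : K → ℝ} {y : A s j → ℝ}
    (hy : y ∈ P.relaxed s j B x) {r : DualVec (N s j) (L s j)} (hr : r ∈ P.dualCone s j B) :
    P.dualObj s j x r ≤ 0 := by
  refine (P.dualObj_le_sum_arcVal s j hy hr.1).trans (Finset.sum_nonpos fun a _ => ?_)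
  by_cases ha : a ∈ B
  · exact mul_nonpos_of_nonneg_of_nonpos (hy.1 a) (hr.2 a ha)
  · simp [hy.2.1 a ha]

theorem exists_basicPoint (s : S) (j : J) {B : Set (A s j)} (h : (P.dualPoly s j B).Nonempty) :
    ∃ w, P.BasicPoint s j B w := by
  obtain ⟨w₀, hw₀⟩ := h
  -- The slice is the trivial one, `0 = 0`.
  obtain ⟨w, hw, -, huniq⟩ := LinIneq.exists_basic (P.dualLhs s j B) (P.dualRhs s j B)
    (dualCoord (N s j) (L s j)) eq_zero_of_dualCoord 0 0
    ⟨w₀, (P.mem_dualPoly_iff s j B w₀).1 hw₀, rfl⟩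
  refine ⟨w, (P.mem_dualPoly_iff s j B w).2 hw, fun w' hN hL hA => ?_⟩
  refine huniq w' (Sum.forall.2 ⟨hN, hL⟩) (Sum.forall.2 ⟨fun l hl => ?_, fun a => ?_⟩) rfl
  · rw [dualLhs_inl] at hl ⊢
    exact neg_eq_zero.2 (hL l (neg_eq_zero.1 hl))
  · by_cases ha : a ∈ B
    · rw [dualLhs_inr P s j ha, dualLhs_inr P s j ha, dualRhs_inr P s j ha]
      exact hA a ha
    · intro _
      rw [dualLhs_inr_of_notMem P s j ha, dualRhs_inr_of_notMem P s j ha]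

/-- Strong duality, with a basic dual solution. -/
theorem strong_duality (s : S) (j : J) {B : Set (A s j)} {x : K → ℝ}
    (hne : (P.dualPoly s j B).Nonempty)
    (hray : ∀ r ∈ P.dualCone s j B, P.dualObj s j x r ≤ 0) :
    ∃ y ∈ P.relaxed s j B x, ∃ w, P.BasicPoint s j B w ∧
      P.flowCost s j y = P.dualObj s j x w := by
  classical
  obtain ⟨w₀, hw₀⟩ := hne
  obtain ⟨v, hv, c, hc, hcd, hcb⟩ := LinIneq.exists_max (P.dualLhs s j B) (P.dualRhs s j B)
    (P.dualObjLin s j x) ⟨w₀, (P.mem_dualPoly_iff s j B w₀).1 hw₀⟩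
    (fun r hr => hray r ((P.mem_dualCone_iff s j B r).2 hr))
  -- A basic point of the optimal face replaces `v`. The multipliers of the arc constraints will be
  -- the primal flow.
  obtain ⟨w, hw, hwv, huniq⟩ := LinIneq.exists_basic (P.dualLhs s j B) (P.dualRhs s j B)
    (dualCoord (N s j) (L s j)) eq_zero_of_dualCoord (P.dualObjLin s j x)
    (P.dualObjLin s j x v) ⟨v, hv, rfl⟩
  set y : A s j → ℝ := fun a => if a ∈ B then c (Sum.inr a) else 0 with hy
  have hobj : ∀ u, P.dualObj s j x u =
      ∑ a, y a * P.arcVal s j u a - ∑ l, c (Sum.inl l) * u.2 l := by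
    intro u
    rw [← dualObjLin_apply, hcd u, Fintype.sum_sum_type, add_comm, sub_eq_add_neg,
      ← Finset.sum_neg_distrib]
    congr 1
    · refine Finset.sum_congr rfl fun a _ => ?_
      by_cases ha : a ∈ B
      · simp [hy, ha, dualLhs_inr P s j ha]
      · simp [hy, ha, dualLhs_inr_of_notMem P s j ha]
    · exact Finset.sum_congr rfl fun l _ => by rw [dualLhs_inl, mul_neg]
  have hcost : P.flowCost s j y = P.dualObjLin s j x v := by
    rw [hcb, Fintype.sum_sum_type]
    simp only [dualRhs, Sum.elim_inl, Sum.elim_inr, Pi.zero_apply, mul_zero,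
      Finset.sum_const_zero, zero_add, flowCost]
    refine Finset.sum_congr rfl fun a _ => ?_
    by_cases ha : a ∈ B
    · simp [hy, ha, mul_comm]
    · simp [hy, ha]
  refine ⟨y, ⟨fun a => ?_, fun a ha => if_neg ha, fun n => ?_, fun l => ?_⟩, w, ⟨?_, ?_⟩, ?_⟩
  · simp only [hy]
    split_ifs
    exacts [hc _, le_rfl]
  -- A unit potential in `hobj` reads off the flow balance at `n`; below, a unit price reads off a
  -- side constraint, with the multiplier of its sign constraint as slack.
  · have h := hobj (Pi.single n 1, 0)
    rw [sum_mul_arcVal, dualObj] at h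
    simpa [Pi.single_apply] using h.symm
  · have h := hobj (0, Pi.single l 1)
    rw [sum_mul_arcVal, dualObj] at h
    have h' : P.demand s j l = (∑ a, P.coef s j a l * y a) - c (Sum.inl l) := by
      simpa [Pi.single_apply] using h
    linarith [hc (Sum.inl l)]
  · exact (P.mem_dualPoly_iff s j B w).2 hw
  · intro w' hN hL hA
    have htight : ∀ i, P.dualLhs s j B i w = P.dualRhs s j B i →
        P.dualLhs s j B i w' = P.dualRhs s j B i := by
      refine Sum.forall.2 ⟨fun l hl => ?_, fun a => ?_⟩
      · rw [dualLhs_inl] at hl ⊢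
        exact neg_eq_zero.2 (hL l (neg_eq_zero.1 hl))
      · by_cases ha : a ∈ B
        · rw [dualLhs_inr P s j ha, dualLhs_inr P s j ha, dualRhs_inr P s j ha]
          exact hA a ha
        · intro _
          rw [dualLhs_inr_of_notMem P s j ha, dualRhs_inr_of_notMem P s j ha]
    refine huniq w' (Sum.forall.2 ⟨hN, hL⟩) htight ?_
    -- `w` is so far unique only within the optimal face. By complementary slackness, constraints
    -- with nonzero multiplier are tight at `w`, hence at `w'`, so `w'` lies on that face
    -- automatically.
    have hslack : ∑ i, c i * P.dualLhs s j B i w = ∑ i, c i * P.dualRhs s j B i := by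
      rw [← hcd w, hwv, hcb]
    rw [Finset.sum_eq_sum_iff_of_le
      fun i _ => mul_le_mul_of_nonneg_left (hw i) (hc i)] at hslack
    rw [hcb, hcd w']
    refine Finset.sum_congr rfl fun i hi => ?_
    rcases eq_or_ne (c i) 0 with h0 | h0
    · simp [h0]
    · rw [htight i (mul_left_cancel₀ h0 (hslack i hi))]
  · rw [hcost, ← dualObjLin_apply, hwv]

/-- Normalising the dual objective to one turns rays into points: uniqueness within this slice of
the cone is uniqueness up to a factor. -/
theorem exists_basicRay (s : S) (j : J) {B : Set (A s j)} {x : K → ℝ}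
    {r₀ : DualVec (N s j) (L s j)} (hr₀ : r₀ ∈ P.dualCone s j B)
    (hpos : 0 < P.dualObj s j x r₀) :
    ∃ r, P.BasicRay s j B r ∧ 0 < P.dualObj s j x r := by
  have hscale : ∃ v, (∀ i, P.dualLhs s j B i v ≤ 0) ∧ P.dualObjLin s j x v = 1 := by
    refine ⟨(P.dualObj s j x r₀)⁻¹ • r₀, fun i => ?_, ?_⟩
    · rw [map_smul, smul_eq_mul]
      exact mul_nonpos_of_nonneg_of_nonpos (inv_nonneg.2 hpos.le)
        ((P.mem_dualCone_iff s j B r₀).1 hr₀ i)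
    · rw [map_smul, smul_eq_mul, dualObjLin_apply, inv_mul_cancel₀ hpos.ne']
  obtain ⟨r, hr, hr1, huniq⟩ := LinIneq.exists_basic (P.dualLhs s j B) (fun _ => 0)
    (dualCoord (N s j) (L s j)) eq_zero_of_dualCoord (P.dualObjLin s j x) 1 hscale
  have hobj : P.dualObj s j x r = 1 := hr1
  refine ⟨r, ⟨(P.mem_dualCone_iff s j B r).2 hr, ?_, fun r' hN hL hA => ?_⟩,
    hobj ▸ zero_lt_one⟩
  · rintro rfl
    rw [map_zero] at hr1
    exact zero_ne_one hr1
  · have hcoord : ∀ m, dualCoord (N s j) (L s j) m r = 0 → dualCoord (N s j) (L s j) m r' = 0 :=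
      Sum.forall.2 ⟨hN, hL⟩
    have htight : ∀ i, P.dualLhs s j B i r = 0 → P.dualLhs s j B i r' = 0 := by
      refine Sum.forall.2 ⟨fun l hl => ?_, fun a => ?_⟩
      · rw [dualLhs_inl] at hl ⊢
        exact neg_eq_zero.2 (hL l (neg_eq_zero.1 hl))
      · by_cases ha : a ∈ B
        · rw [dualLhs_inr P s j ha, dualLhs_inr P s j ha]
          exact hA a ha
        · intro _
          rw [dualLhs_inr_of_notMem P s j ha]
    -- shift by a multiple of `r` to obtain dual objective one
    have h := huniq (r' + (1 - P.dualObjLin s j x r') • r)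
      (fun m hm => by rw [map_add, map_smul, hm, hcoord m hm, smul_zero, add_zero])
      (fun i hi => by rw [map_add, map_smul, hi, htight i hi, smul_zero, add_zero])
      (by rw [map_add, map_smul, hr1, smul_eq_mul]; ring)
    refine ⟨P.dualObjLin s j x r', ?_⟩
    rw [sub_smul, one_smul] at h
    have h2 : r' + (r - (P.dualObjLin s j x) r' • r) =
      r + (r' - (P.dualObjLin s j x) r' • r) := by abel
    rw [h2, add_eq_left] at h
    exact sub_eq_zero.1 h

theorem dualPoly_anti (s : S) (j : J) {B C : Set (A s j)} (h : B ⊆ C) :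
    P.dualPoly s j C ⊆ P.dualPoly s j B := fun _ hw => ⟨hw.1, fun a ha => hw.2 a (h ha)⟩

/-- An LP solver has a correct answer for every restricted relaxation. -/
theorem exists_solves (s : S) (j : J) (B : Set (A s j)) (x : K → ℝ)
    (hdual : (P.dualPoly s j Set.univ).Nonempty) :
    ∃ res, P.Solves s j B x res := by
  by_cases h : ∃ r ∈ P.dualCone s j B, 0 < P.dualObj s j x r
  · obtain ⟨r₀, hr₀, hpos⟩ := h
    obtain ⟨r, hr, hrpos⟩ := P.exists_basicRay s j hr₀ hpos
    refine ⟨.infeasible r, Set.eq_empty_iff_forall_notMem.2 fun y hy => ?_, hr, hrpos⟩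
    exact absurd (P.dualObj_nonpos s j hy hr.1) (not_le.2 hrpos)
  · push Not at h
    obtain ⟨y, hy, w, hw, heq⟩ :=
      P.strong_duality s j (hdual.mono (P.dualPoly_anti s j (Set.subset_univ B))) h
    exact ⟨.solved y w, ⟨hy, fun y' hy' => heq ▸ P.dualObj_le_flowCost s j hy' hw.1⟩, hw,
      fun w' hw' => heq ▸ P.dualObj_le_flowCost s j hy hw'⟩

/-- Optimal primal and dual solutions have the same value. -/
theorem flowCost_eq_dualObj (s : S) (j : J) {B : Set (A s j)} {x : K → ℝ} {y : A s j → ℝ}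
    {w : DualVec (N s j) (L s j)} (h : P.Solves s j B x (.solved y w)) :
    P.flowCost s j y = P.dualObj s j x w := by
  obtain ⟨⟨hy, hymin⟩, hw, hwmax⟩ := h
  obtain ⟨y₀, hy₀, w₀, hw₀, heq⟩ :=
    P.strong_duality s j ⟨w, hw.1⟩ (fun r hr => P.dualObj_nonpos s j hy hr)
  refine le_antisymm ?_ (P.dualObj_le_flowCost s j hy hw.1)
  calc P.flowCost s j y ≤ P.flowCost s j y₀ := hymin y₀ hy₀
    _ = P.dualObj s j x w₀ := heq
    _ ≤ P.dualObj s j x w := hwmax w₀ hw₀.1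

/-- Further satisfied constraints can only add tight ones, so the determining system grows. Thus
cuts priced out on restricted arc sets belong to the finite family of the full polyhedron. -/
theorem BasicPoint.univ_of_price {P : Program S J K M N A L} {s : S} {j : J} {B : Set (A s j)}
    {w : DualVec (N s j) (L s j)} (h : P.BasicPoint s j B w)
    (hprice : ∀ a, P.arcVal s j w a ≤ P.arcCost s j a) : P.BasicPoint s j Set.univ w :=
  ⟨⟨h.1.1, fun a _ => hprice a⟩,
    fun w' hN hL hA => h.2 w' hN hL fun a _ => hA a (Set.mem_univ a)⟩

theorem BasicRay.univ_of_price {P : Program S J K M N A L} {s : S} {j : J} {B : Set (A s j)}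
    {r : DualVec (N s j) (L s j)} (h : P.BasicRay s j B r)
    (hprice : ∀ a, P.arcVal s j r a ≤ 0) : P.BasicRay s j Set.univ r :=
  ⟨⟨h.1.1, fun a _ => hprice a⟩, h.2.1,
    fun w' hN hL hA => h.2.2 w' hN hL fun a _ => hA a (Set.mem_univ a)⟩

/-- An answer to a restricted relaxation has nonnegative reduced costs on the generated arcs. -/
theorem reducedCost_nonneg (s : S) (j : J) {B : Set (A s j)} {x : K → ℝ}
    {res : SubResult (N s j) (A s j) (L s j)} (h : P.Solves s j B x res) {a : A s j}
    (ha : a ∈ B) : 0 ≤ P.reducedCost s j a res := by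
  cases res with
  | solved y w => exact sub_nonneg.2 (h.2.1.1.2 a ha)
  | infeasible r => exact sub_nonneg.2 (h.2.1.1.2 a ha)

/-! ### Finiteness of the Benders cuts -/

/-- Signs of the coordinates, and tightness pattern for the arc costs `q`, of a dual vector. -/
noncomputable def signature (s : S) (j : J) (q : A s j → ℝ) (w : DualVec (N s j) (L s j)) :
    ((N s j → SignType) × (L s j → SignType)) × Set (A s j) :=
  ((fun n => SignType.sign (w.1 n), fun l => SignType.sign (w.2 l)),
    {a | P.arcVal s j w a = q a})

theorem signature_eq_iff (s : S) (j : J) (q : A s j → ℝ) (w w' : DualVec (N s j) (L s j)) :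
    P.signature s j q w = P.signature s j q w' ↔
      ((∀ n, SignType.sign (w.1 n) = SignType.sign (w'.1 n)) ∧
        ∀ l, SignType.sign (w.2 l) = SignType.sign (w'.2 l)) ∧
      ∀ a, P.arcVal s j w a = q a ↔ P.arcVal s j w' a = q a := by
  simp only [signature, Prod.mk.injEq, funext_iff, Set.ext_iff, Set.mem_ofPred_eq]

theorem BasicPoint.eq_of_signature {P : Program S J K M N A L} {s : S} {j : J}
    {w w' : DualVec (N s j) (L s j)} (h : P.BasicPoint s j Set.univ w)
    (hsig : P.signature s j (P.arcCost s j) w = P.signature s j (P.arcCost s j) w') :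
    w' = w := by
  rw [signature_eq_iff] at hsig
  refine h.2 w' (fun n hn => ?_) (fun l hl => ?_) fun a _ => (hsig.2 a).1
  · have := hsig.1.1 n
    rw [hn, sign_zero] at this
    exact sign_eq_zero_iff.1 this.symm
  · have := hsig.1.2 l
    rw [hl, sign_zero] at this
    exact sign_eq_zero_iff.1 this.symm

/-- Zeros and tightness give a multiple; a common nonzero sign in some coordinate makes the factor
positive, so both rays define the same feasibility cut. This is why signatures record signs and not
only zeros. -/
theorem BasicRay.exists_pos_smul_of_signature {P : Program S J K M N A L} {s : S} {j : J}
    {r r' : DualVec (N s j) (L s j)} (h : P.BasicRay s j Set.univ r)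
    (hsig : P.signature s j 0 r = P.signature s j 0 r') : ∃ t : ℝ, 0 < t ∧ r' = t • r := by
  rw [signature_eq_iff] at hsig
  obtain ⟨t, rfl⟩ := h.2.2 r' (fun n hn => by
      have := hsig.1.1 n
      rw [hn, sign_zero] at this
      exact sign_eq_zero_iff.1 this.symm)
    (fun l hl => by
      have := hsig.1.2 l
      rw [hl, sign_zero] at this
      exact sign_eq_zero_iff.1 this.symm)
    (fun a _ => (hsig.2 a).1)
  refine ⟨t, ?_, rfl⟩
  have key : ∀ u : ℝ, SignType.sign u = SignType.sign (t * u) → u ≠ 0 → 0 < t := by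
    intro u hu hu0
    rw [sign_mul] at hu
    have h0 : SignType.sign u ≠ 0 := sign_ne_zero.2 hu0
    refine sign_eq_one_iff.1 ?_
    generalize SignType.sign u = p at *
    generalize SignType.sign t = q at *
    revert p q
    decide
  by_contra hle
  refine h.2.1 (Prod.ext (funext fun n => ?_) (funext fun l => ?_))
  · by_contra h0
    exact hle (key _ (hsig.1.1 n) h0)
  · by_contra h0
    exact hle (key _ (hsig.1.2 l) h0)

theorem finite_basicPoint (s : S) (j : J) : {w | P.BasicPoint s j Set.univ w}.Finite := by
  refine Set.Finite.of_finite_image (f := P.signature s j (P.arcCost s j)) (Set.toFinite _) ?_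
  intro w hw w' _ hsig
  exact (BasicPoint.eq_of_signature hw hsig).symm

/-! ### The master relaxation -/

theorem continuous_rhs (s : S) (j : J) (n : N s j) : Continuous fun x => P.rhs s j x n := by
  unfold rhs
  fun_prop

theorem continuous_dualObj (s : S) (j : J) (w : DualVec (N s j) (L s j)) :
    Continuous fun x => P.dualObj s j x w := by
  have := P.continuous_rhs s j
  unfold dualObj
  fun_prop

theorem isClosed_region (n : Node K) : IsClosed (P.region n) := by
  have h : P.region n = (⋂ i, {x | P.vec i ≤ ∑ k, P.mat i k * x k}) ∩
      ((⋂ k ∈ P.intIdx, {x : K → ℝ | (n.lo k : ℝ) ≤ x k} ∩ {x | x k ≤ n.hi k}) ∩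
        ⋂ c ∈ n.cuts, {x : K → ℝ | c.2 ≤ ∑ k, c.1 k * x k}) := by
    ext x
    simp [region, firstStage]
  rw [h]
  refine (isClosed_iInter fun i => isClosed_le (by fun_prop) (by fun_prop)).inter
    ((isClosed_biInter fun k _ => ?_).inter (isClosed_biInter fun c _ => ?_))
  · exact (isClosed_le (by fun_prop) (by fun_prop)).inter (isClosed_le (by fun_prop) (by fun_prop))
  · exact isClosed_le (by fun_prop) (by fun_prop)

/-- A feasible master relaxation has an optimal solution. -/
theorem exists_masterOptimal (hbounded : Bornology.IsBounded P.firstStage)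
    (st : State S J K N A L) (n : Node K) (hne : ∀ s j, (st.optCuts s j).Nonempty)
    (hfin : ∀ s j, (st.optCuts s j).Finite) (hfeas : ∃ x θ, P.MasterFeasible st n x θ) :
    ∃ x θ, P.MasterOptimal st n x θ := by
  have hne' : ∀ s j, (hfin s j).toFinset.Nonempty := fun s j => by simpa using hne s j
  set X : Set (K → ℝ) :=
    P.region n ∩ ⋂ s, ⋂ j, ⋂ r ∈ st.feasCuts s j, {x | P.dualObj s j x r ≤ 0} with hX
  have hXmem : ∀ x, x ∈ X ↔
      x ∈ P.region n ∧ ∀ s j, ∀ r ∈ st.feasCuts s j, P.dualObj s j x r ≤ 0 := by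
    intro x
    simp [hX]
  -- Closedness needs no finiteness of the feasibility cuts; only the optimality cuts must be
  -- finite, for the maximum below.
  have hcompact : IsCompact X := by
    refine Metric.isCompact_of_isClosed_isBounded ?_ (hbounded.subset fun x hx => hx.1.1)
    exact (P.isClosed_region n).inter (isClosed_iInter fun s => isClosed_iInter fun j =>
      isClosed_biInter fun r _ => isClosed_le (P.continuous_dualObj s j r) continuous_const)
  -- For fixed `x` the largest optimality cut is a best choice of `θ`, as probabilities are
  -- nonnegative; a continuous function of `x` alone remains.
  set θ : (K → ℝ) → S → J → ℝ := fun x s j =>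
    (hfin s j).toFinset.sup' (hne' s j) fun w => P.dualObj s j x w with hθ
  have hcont : Continuous fun x => P.masterObj x (θ x) := by
    have : ∀ s j, Continuous fun x => θ x s j := fun s j =>
      Continuous.finset_sup'_apply (hne' s j) fun w _ => P.continuous_dualObj s j w
    unfold masterObj
    fun_prop
  obtain ⟨x₀, θ₀, h₀⟩ := hfeas
  obtain ⟨x, hx, hmin⟩ :=
    hcompact.exists_isMinOn ⟨x₀, (hXmem x₀).2 ⟨h₀.1, h₀.2.2⟩⟩ hcont.continuousOn
  refine ⟨x, θ x, ⟨((hXmem x).1 hx).1, fun s j w hw => ?_, ((hXmem x).1 hx).2⟩,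
    fun x' θ' h' => ?_⟩
  · exact Finset.le_sup' (fun w => P.dualObj s j x w) (by simpa using hw)
  · refine (hmin ((hXmem x').2 ⟨h'.1, h'.2.2⟩)).trans ?_
    refine add_le_add le_rfl (Finset.sum_le_sum fun s _ => Finset.sum_le_sum fun j _ =>
      mul_le_mul_of_nonneg_left ?_ (P.prob_nonneg s))
    exact Finset.sup'_le _ _ fun w hw => h'.2.1 s j w (by simpa using hw)

/-- A solution of the second-stage relaxation gives a solution of the master relaxation. -/
theorem masterFeasible_of_relaxed {st : State S J K N A L} {n : Node K} {x : K → ℝ}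
    {y : ∀ s j, A s j → ℝ} (hx : x ∈ P.region n)
    (hy : ∀ s j, y s j ∈ P.relaxed s j Set.univ x)
    (hopt : ∀ s j, ∀ w ∈ st.optCuts s j, P.BasicPoint s j Set.univ w)
    (hfeas : ∀ s j, ∀ r ∈ st.feasCuts s j, P.BasicRay s j Set.univ r) :
    P.MasterFeasible st n x fun s j => P.flowCost s j (y s j) :=
  ⟨hx, fun s j w hw => P.dualObj_le_flowCost s j (hy s j) (hopt s j w hw).1,
    fun s j r hr => P.dualObj_nonpos s j (hy s j) (hfeas s j r hr).1⟩

/-! ### Branching -/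

theorem exists_mem_children (R : ℕ) {n : Node K} {k : K} (v : ℤ) {x : K → ℝ}
    (hx : x ∈ P.region n) (hint : ∃ m : ℤ, x k = m) :
    ∃ n' ∈ children R n k v, x ∈ P.region n' := by
  classical
  obtain ⟨m, hm⟩ := hint
  rcases le_or_gt m v with h | h
  · refine ⟨{ n with hi := Function.update n.hi k v, rounds := R }, by simp [children], hx.1,
      fun i hi => ⟨(hx.2.1 i hi).1, ?_⟩, hx.2.2⟩
    rcases eq_or_ne i k with rfl | hik
    · simp only [Function.update_self]
      rw [hm]
      exact_mod_cast h
    · simpa [Function.update_of_ne hik] using (hx.2.1 i hi).2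
  · refine ⟨{ n with lo := Function.update n.lo k (v + 1), rounds := R },
      by simp [children], hx.1,
      fun i hi => ⟨?_, (hx.2.1 i hi).2⟩, hx.2.2⟩
    rcases eq_or_ne i k with rfl | hik
    · simp only [Function.update_self]
      rw [hm]
      exact_mod_cast h
    · simpa [Function.update_of_ne hik] using (hx.2.1 i hi).1

open scoped Classical in
/-- Total width of the box of a node in the integer directions. -/
noncomputable def boxSize (n : Node K) : ℕ :=
  ∑ k with k ∈ P.intIdx, (n.hi k - n.lo k).toNat

/-- A potential that exceeds the sum of those of the children of a split, and decreases with every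
round of cuts. -/
noncomputable def weight (R : ℕ) (n : Node K) : ℕ := 3 ^ ((R + 1) * P.boxSize n + n.rounds)

theorem weight_pos (R : ℕ) (n : Node K) : 0 < P.weight R n := by
  unfold weight
  positivity

/-- The box shrinks by at least one, lowering the exponent by `R + 1`, while renewed rounds add back
at most `R`. Each child thus weighs at most a third of the parent. -/
theorem sum_weight_children_lt (R : ℕ) {n : Node K} {k : K} {v : ℤ} (hk : k ∈ P.intIdx)
    (hlo : n.lo k ≤ v) (hhi : v < n.hi k) :
    ((children R n k v).map (P.weight R)).sum < P.weight R n := by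
  classical
  have hsize : ∀ n' : Node K, (∀ i, i ≠ k → n'.hi i = n.hi i ∧ n'.lo i = n.lo i) →
      (n'.hi k - n'.lo k).toNat < (n.hi k - n.lo k).toNat → P.boxSize n' < P.boxSize n := by
    intro n' hne hlt
    unfold boxSize
    refine Finset.sum_lt_sum (fun i _ => ?_) ⟨k, by simp [hk], hlt⟩
    rcases eq_or_ne i k with rfl | hik
    · exact hlt.le
    · rw [(hne i hik).1, (hne i hik).2]
  have hweight : ∀ n' : Node K, P.boxSize n' < P.boxSize n → n'.rounds = R →
      3 * P.weight R n' ≤ P.weight R n := by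
    intro n' hlt hr
    unfold weight
    rw [hr, ← pow_succ']
    refine Nat.pow_le_pow_right (by norm_num) ?_
    have := Nat.mul_le_mul_left (R + 1) (Nat.succ_le_of_lt hlt)
    rw [Nat.succ_eq_add_one, mul_add, mul_one] at this
    omega
  have h1 := hweight { n with hi := Function.update n.hi k v, rounds := R } (hsize _
    (fun i hi => by simp [hi]) (by simp only [Function.update_self]; omega)) rfl
  have h2 := hweight { n with lo := Function.update n.lo k (v + 1), rounds := R } (hsize _
    (fun i hi => by simp [hi]) (by simp only [Function.update_self]; omega)) rfl
  have h3 := P.weight_pos R n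
  have h4 : ((children R n k v).map (P.weight R)).sum =
      P.weight R { n with hi := Function.update n.hi k v, rounds := R } +
        P.weight R { n with lo := Function.update n.lo k (v + 1), rounds := R } := by
    simp only [children, Multiset.insert_eq_cons, Multiset.map_cons, Multiset.map_singleton,
      Multiset.sum_cons, Multiset.sum_singleton]
  rw [h4]
  omega

theorem sum_weight_expansion_lt (R : ℕ) {n : Node K} {q : Multiset (Node K)}
    (h : P.Expansion R n q) : (q.map (P.weight R)).sum < P.weight R n := by
  rcases h with ⟨-, rfl⟩ | ⟨k, hk, v, hlo, hhi, rfl⟩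
  · simpa using P.weight_pos R n
  · exact P.sum_weight_children_lt R hk hlo hhi

theorem exists_expansion (R : ℕ) (n : Node K) : ∃ q, P.Expansion R n q := by
  by_cases h : ∀ k ∈ P.intIdx, n.hi k ≤ n.lo k
  · exact ⟨0, Or.inl ⟨h, rfl⟩⟩
  · push Not at h
    obtain ⟨k, hk, hlt⟩ := h
    exact ⟨_, Or.inr ⟨k, hk, n.lo k, le_rfl, hlt, rfl⟩⟩

theorem lo_le_floor {n : Node K} {x : K → ℝ} (hx : x ∈ P.region n) {k : K} (hk : k ∈ P.intIdx) :
    n.lo k ≤ ⌊x k⌋ := Int.le_floor.2 (hx.2.1 k hk).1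

theorem floor_lt_hi {n : Node K} {x : K → ℝ} (hx : x ∈ P.region n) {k : K} (hk : k ∈ P.intIdx)
    (hfrac : ∀ m : ℤ, x k ≠ m) : ⌊x k⌋ < n.hi k :=
  Int.floor_lt.2 (lt_of_le_of_ne (hx.2.1 k hk).2 (hfrac _))

/-! ### Invariants -/

/-- The phase is consistent with the current cuts. -/
def PhaseOk (st : State S J K N A L) : Prop :=
  match st.phase with
  | .select => True
  | .sub n x θ => P.MasterOptimal st n x θ
  | .frac n x => x ∈ P.region n ∧ ¬ P.Integral x

/-- Some completion of a stored first-stage solution costs at most `z`. -/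
def PoolBound (pool : List (K → ℝ)) (z : ℝ) : Prop :=
  ∃ x ∈ pool, ∃ y, P.Recourse x y ∧ P.total x y ≤ z

/-- What holds at every state that the algorithm reaches. -/
structure Invariant (st : State S J K N A L) : Prop where
  optCuts_nonempty : ∀ s j, (st.optCuts s j).Nonempty
  optCuts_basic : ∀ s j, ∀ w ∈ st.optCuts s j, P.BasicPoint s j Set.univ w
  feasCuts_basic : ∀ s j, ∀ r ∈ st.feasCuts s j, P.BasicRay s j Set.univ r
  phase_ok : P.PhaseOk st
  pool_mem : ∀ x ∈ st.pool, x ∈ P.firstStage ∧ P.Integral x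
  -- Quantifying over real `z` makes the condition vacuous while the bound is still infinite.
  ub_attained : ∀ z : ℝ, st.ub ≤ (z : WithTop ℝ) → P.PoolBound st.pool z
  covered : ∀ x y, P.Feasible x y →
    (∃ n ∈ st.openNodes, x ∈ P.region n) ∨ P.PoolBound st.pool (P.total x y)

theorem Invariant.of_init {P : Program S J K M N A L} {R : ℕ} {st : State S J K N A L}
    (h : P.Init R st) : P.Invariant st := by
  obtain ⟨⟨lo, hi, hbox, hq⟩, hphase, hopt, hfeas, hub, hpool⟩ := h
  refine ⟨fun s j => (hopt s j).1, fun s j => (hopt s j).2, hfeas, ?_, ?_, ?_, ?_⟩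
  · simp [PhaseOk, hphase]
  · simp [hpool]
  · intro z hz
    rw [hub, top_le_iff] at hz
    exact absurd hz (WithTop.coe_ne_top)
  · intro x y hxy
    refine Or.inl ⟨⟨lo, hi, [], R⟩, ?_, hxy.1, hbox x hxy.1, by simp⟩
    simp [State.openNodes, hphase, hq]

theorem PoolBound.mono {P : Program S J K M N A L} {pool pool' : List (K → ℝ)} {z z' : ℝ}
    (h : P.PoolBound pool z) (hp : pool ⊆ pool') (hz : z ≤ z') : P.PoolBound pool' z' := by
  obtain ⟨x, hx, y, hy, hle⟩ := h
  exact ⟨x, hp hx, y, hy, hle.trans hz⟩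

/-- The optimal value of the master relaxation is a lower bound for the node. -/
theorem MasterOptimal.le_total {P : Program S J K M N A L} {st : State S J K N A L} {n : Node K}
    {x : K → ℝ} {θ : S → J → ℝ} (h : P.MasterOptimal st n x θ)
    (hopt : ∀ s j, ∀ w ∈ st.optCuts s j, P.BasicPoint s j Set.univ w)
    (hfeas : ∀ s j, ∀ r ∈ st.feasCuts s j, P.BasicRay s j Set.univ r)
    {x' : K → ℝ} {y' : ∀ s j, A s j → ℝ} (hx' : x' ∈ P.region n) (hy' : P.Recourse x' y') :
    P.masterObj x θ ≤ P.total x' y' :=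
  h.2 _ _ (P.masterFeasible_of_relaxed hx' (fun s j => (hy' s j).1) hopt hfeas)

/-- If no Benders cut is violated, the second-stage relaxation costs at most the master value. -/
theorem total_le_masterObj {x : K → ℝ} {θ : S → J → ℝ} {B : ∀ s j, Set (A s j)}
    {y : ∀ s j, A s j → ℝ} {w : ∀ s j, DualVec (N s j) (L s j)}
    (hres : ∀ s j, P.Solves s j (B s j) x (.solved (y s j) (w s j)))
    (hviol : ∀ s j, ¬ P.Violated s j x (θ s j) (.solved (y s j) (w s j))) :
    P.total x y ≤ P.masterObj x θ := by
  refine add_le_add le_rfl (Finset.sum_le_sum fun s _ => Finset.sum_le_sum fun j _ =>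
    mul_le_mul_of_nonneg_left ?_ (P.prob_nonneg s))
  rw [P.flowCost_eq_dualObj s j (hres s j)]
  exact not_lt.1 (hviol s j)

/-- This is where the linking hypothesis enters: continuous first-stage variables are invisible to
the second stage. -/
theorem rhs_congr {x x' : K → ℝ}
    (hlink : ∀ s j n k, P.block k = j → k ∉ P.intIdx → P.supply s j n k = 0)
    (h : ∀ k ∈ P.intIdx, x k = x' k) (s : S) (j : J) (n : N s j) :
    P.rhs s j x n = P.rhs s j x' n := by
  classical
  unfold rhs
  refine Finset.sum_congr rfl fun k hk => ?_
  by_cases hki : k ∈ P.intIdx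
  · rw [h k hki]
  · rw [hlink s j n k (Finset.mem_filter.1 hk).2 hki, zero_mul, zero_mul]

/-- If all integer variables are fixed, the stored solution dominates the solutions of the node. -/
theorem poolBound_of_fixed
    (hlink : ∀ s j n k, P.block k = j → k ∉ P.intIdx → P.supply s j n k = 0)
    {st : State S J K N A L} {n : Node K} {x x' : K → ℝ} {θ : S → J → ℝ}
    {y' : ∀ s j, A s j → ℝ} {pool : List (K → ℝ)} (hopt : P.MasterOptimal st n x θ)
    (hfix : ∀ k ∈ P.intIdx, n.hi k ≤ n.lo k) (hx' : x' ∈ P.region n) (hy' : P.Recourse x' y')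
    (hpool : x ∈ pool) : P.PoolBound pool (P.total x' y') := by
  have heq : ∀ k ∈ P.intIdx, x k = x' k := fun k hk => by
    have h0 : (n.hi k : ℝ) ≤ n.lo k := by exact_mod_cast hfix k hk
    have h1 := hopt.1.1.2.1 k hk
    have h2 := hx'.2.1 k hk
    linarith [h1.1, h1.2, h2.1, h2.2]
  have hrhs := P.rhs_congr hlink heq
  have hdual : ∀ s j w, P.dualObj s j x w = P.dualObj s j x' w := fun s j w => by
    simp only [dualObj, hrhs]
  -- The Benders cuts do not distinguish `x` from `x'`, so `θ` can be kept and master optimality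
  -- compares first-stage costs alone.
  have hle := hopt.2 x' θ ⟨hx', fun s j w hw => hdual s j w ▸ hopt.1.2.1 s j w hw,
    fun s j r hr => hdual s j r ▸ hopt.1.2.2 s j r hr⟩
  refine ⟨x, hpool, y', fun s j => ⟨⟨(hy' s j).1.1, (hy' s j).1.2.1, fun m => ?_,
    (hy' s j).1.2.2.2⟩, (hy' s j).2⟩, ?_⟩
  · rw [hrhs]
    exact (hy' s j).1.2.2.1 m
  · simp only [masterObj, total] at hle ⊢
    linarith

theorem Invariant.step {P : Program S J K M N A L} {R : ℕ}
    (hlink : ∀ s j n k, P.block k = j → k ∉ P.intIdx → P.supply s j n k = 0)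
    {st st' : State S J K N A L} (h : P.Invariant st) (hstep : P.Step R st st') :
    P.Invariant st' := by
  have hok := h.phase_ok
  have hcov := h.covered
  cases hstep with
  | pruneInfeasible n q hphase hq hinf =>
    refine ⟨h.1, h.2, h.3, by simp [PhaseOk, hphase], h.5, h.6, fun x y hxy => ?_⟩
    refine (hcov x y hxy).imp_left ?_
    rintro ⟨n', hn', hx⟩
    simp only [State.openNodes, hphase, hq, Multiset.mem_cons] at hn' ⊢
    rcases hn' with rfl | hn'
    · exact absurd (P.masterFeasible_of_relaxed hx (fun s j => (hxy.2.2 s j).1) h.2 h.3)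
        (hinf _ _)
    · exact ⟨n', hn', hx⟩
  | pruneBound n q x θ hphase hq hopt hub =>
    refine ⟨h.1, h.2, h.3, by simp [PhaseOk, hphase], h.5, h.6, fun x' y' hxy => ?_⟩
    rcases hcov x' y' hxy with ⟨n', hn', hx⟩ | hb
    · simp only [State.openNodes, hphase, hq, Multiset.mem_cons] at hn' ⊢
      rcases hn' with rfl | hn'
      · exact Or.inr ((h.ub_attained _ hub).mono (List.Subset.refl _)
          (hopt.le_total h.2 h.3 hx hxy.2.2))
      · exact Or.inl ⟨n', hn', hx⟩
    · exact Or.inr hb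
  | enterSub n q x θ hphase hq hopt hub =>
    refine ⟨h.1, h.2, h.3, hopt, h.5, h.6, fun x y hxy => ?_⟩
    simpa only [State.openNodes, hphase, hq] using hcov x y hxy
  | enterFrac n q x θ hphase hq hopt hub hfrac =>
    refine ⟨h.1, h.2, h.3, ⟨hopt.1.1, hfrac⟩, h.5, h.6, fun x y hxy => ?_⟩
    simpa only [State.openNodes, hphase, hq] using hcov x y hxy
  | addArcs n x θ res new hphase hres hneg hnew hadd =>
    exact ⟨h.1, h.2, h.3, hok, h.5, h.6, hcov⟩
  | addCuts n x θ res hphase hres hprice hviol =>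
    refine ⟨fun s j => (h.1 s j).mono Set.subset_union_left, fun s j w hw => ?_,
      fun s j r hr => ?_, trivial, h.5, h.6, fun x y hxy => ?_⟩
    · rcases hw with hw | ⟨y, hy⟩
      · exact h.2 s j w hw
      · have h1 := hres s j
        have h2 := hprice s j
        rw [hy] at h1 h2
        exact h1.2.1.univ_of_price fun a => sub_nonneg.1 (h2 a)
    · rcases hr with hr | hr
      · exact h.3 s j r hr
      · have h1 := hres s j
        have h2 := hprice s j
        rw [show res s j = .infeasible r from hr] at h1 h2
        exact h1.2.1.univ_of_price fun a => sub_nonneg.1 (h2 a)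
    · simpa only [State.openNodes, hphase] using hcov x y hxy
  | separated n x θ res hphase hres hprice hviol hfrac =>
    simp only [PhaseOk, hphase] at hok
    refine ⟨h.1, h.2, h.3, ⟨hok.1.1, hfrac⟩, h.5, h.6, fun x y hxy => ?_⟩
    simpa only [State.openNodes, hphase] using hcov x y hxy
  | pruneLower n x θ y w hphase hres hprice hviol hint hub =>
    simp only [PhaseOk, hphase] at hok
    refine ⟨h.1, h.2, h.3, trivial, h.5, h.6, fun x' y' hxy => ?_⟩
    rcases hcov x' y' hxy with ⟨n', hn', hx⟩ | hb
    · simp only [State.openNodes, hphase, Multiset.mem_cons] at hn' ⊢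
      rcases hn' with rfl | hn'
      -- Chain: upper bound, relaxation value at `x`, master value, cost of any solution in the
      -- node.
      · exact Or.inr ((h.ub_attained _ hub).mono (List.Subset.refl _)
          ((P.total_le_masterObj hres hviol).trans (hok.le_total h.2 h.3 hx hxy.2.2)))
      · exact Or.inl ⟨n', hn', hx⟩
    · exact Or.inr hb
  | store n x θ y w u q hphase hres hprice hviol hint hub hu hexp =>
    simp only [PhaseOk, hphase] at hok
    refine ⟨h.1, h.2, h.3, trivial, ?_, ?_, fun x' y' hxy => ?_⟩
    · intro x' hx'
      rcases List.mem_cons.1 hx' with rfl | hx'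
      · exact ⟨hok.1.1.1, hint⟩
      · exact h.5 x' hx'
    · intro z hz
      have hold : st.ub ≤ (z : WithTop ℝ) → P.PoolBound (x :: st.pool) z :=
        fun hz => (h.6 z hz).mono (List.subset_cons_self _ _) le_rfl
      rcases hu with rfl | ⟨y', hy', rfl⟩
      · exact hold hz
      · rcases min_le_iff.1 hz with hz | hz
        · exact hold hz
        · exact ⟨x, List.mem_cons_self, y', hy', WithTop.coe_le_coe.1 hz⟩
    · rcases hcov x' y' hxy with ⟨n', hn', hx⟩ | hb
      · simp only [State.openNodes, hphase, Multiset.mem_cons, Multiset.mem_add] at hn' ⊢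
        rcases hn' with rfl | hn'
        · rcases hexp with ⟨hfix, -⟩ | ⟨k, hk, v, -, -, rfl⟩
          · exact Or.inr (P.poolBound_of_fixed hlink hok hfix hx hxy.2.2 List.mem_cons_self)
          · obtain ⟨n'', hn'', hx''⟩ := P.exists_mem_children R v hx (hxy.2.1 k hk)
            exact Or.inl ⟨n'', Or.inl hn'', hx''⟩
        · exact Or.inl ⟨n', Or.inr hn', hx⟩
      · exact Or.inr (hb.mono (List.subset_cons_self _ _) le_rfl)
  | mioCut n x c m hphase hround hvalid hcut =>
    refine ⟨h.1, h.2, h.3, trivial, h.5, h.6, fun x' y' hxy => ?_⟩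
    refine (hcov x' y' hxy).imp_left ?_
    rintro ⟨n', hn', hx⟩
    simp only [State.openNodes, hphase, Multiset.mem_cons] at hn' ⊢
    rcases hn' with rfl | hn'
    · exact ⟨_, Or.inl rfl, hx.1, hx.2.1, List.forall_mem_cons.2 ⟨hvalid x' hx hxy.2.1, hx.2.2⟩⟩
    · exact ⟨n', Or.inr hn', hx⟩
  | branch n x k hphase hk hfrac =>
    refine ⟨h.1, h.2, h.3, trivial, h.5, h.6, fun x' y' hxy => ?_⟩
    refine (hcov x' y' hxy).imp_left ?_
    rintro ⟨n', hn', hx⟩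
    simp only [State.openNodes, hphase, Multiset.mem_cons, Multiset.mem_add] at hn' ⊢
    rcases hn' with rfl | hn'
    · obtain ⟨n'', hn'', hx''⟩ := P.exists_mem_children R ⌊x k⌋ hx (hxy.2.1 k hk)
      exact ⟨n'', Or.inl hn'', hx''⟩
    · exact ⟨n', Or.inr hn', hx⟩

theorem Reachable.invariant {P : Program S J K M N A L} {R : ℕ}
    (hlink : ∀ s j n k, P.block k = j → k ∉ P.intIdx → P.supply s j n k = 0)
    {st : State S J K N A L} (h : P.Reachable R st) : P.Invariant st := by
  obtain ⟨st₀, h0, hsteps⟩ := h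
  induction hsteps with
  | refl => exact .of_init h0
  | tail _ hstep ih => exact ih.step hlink hstep

/-! ### Progress -/

theorem exists_init (hbounded : Bornology.IsBounded P.firstStage)
    (hdual : ∀ s j, (P.dualPoly s j Set.univ).Nonempty) (R : ℕ) :
    ∃ st : State S J K N A L, P.Init R st := by
  obtain ⟨C, hC⟩ := hbounded.exists_norm_le
  choose w hw using fun s j => P.exists_basicPoint s j (hdual s j)
  -- The root box comes from a norm bound `C` on the first-stage polyhedron, rounded outwards.
  refine ⟨⟨{⟨fun _ => ⌊-C⌋, fun _ => ⌈C⌉, [], R⟩}, .select, fun s j => {w s j}, fun _ _ => ∅,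
    fun _ _ => ∅, ⊤, []⟩, ⟨_, _, fun x hx k _ => ?_, rfl⟩, rfl,
    fun s j => ⟨Set.singleton_nonempty _, fun w' hw' => ?_⟩, fun s j r hr => hr.elim, rfl, rfl⟩
  · have h := abs_le.1 ((norm_le_pi_norm x k).trans (hC x hx))
    exact ⟨(Int.floor_le _).trans h.1, h.2.trans (Int.le_ceil _)⟩
  · rw [Set.mem_singleton_iff.1 hw']
    exact hw s j

/-- Optional choices never block a run: the subproblem may be entered from any master solution, the
heuristic may find nothing, and branching needs no cut. -/
theorem Invariant.exists_step {P : Program S J K M N A L} {R : ℕ}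
    (hbounded : Bornology.IsBounded P.firstStage)
    (hdual : ∀ s j, (P.dualPoly s j Set.univ).Nonempty)
    {st : State S J K N A L} (h : P.Invariant st) (hst : ¬ st.Terminal) :
    ∃ st', P.Step R st st' := by
  have hok := h.phase_ok
  cases hphase : st.phase with
  | select =>
    have hq : st.queue ≠ 0 := fun h0 => hst ⟨hphase, h0⟩
    obtain ⟨n, hn⟩ := Multiset.exists_mem_of_ne_zero hq
    obtain ⟨q, hq⟩ := Multiset.exists_cons_of_mem hn
    by_cases hfeas : ∃ x θ, P.MasterFeasible st n x θ
    · obtain ⟨x, θ, hopt⟩ := P.exists_masterOptimal hbounded st n h.1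
        (fun s j => (P.finite_basicPoint s j).subset (h.2 s j)) hfeas
      rcases le_or_gt st.ub (P.masterObj x θ : WithTop ℝ) with hub | hub
      · exact ⟨_, .pruneBound st n q x θ hphase hq hopt hub⟩
      · exact ⟨_, .enterSub st n q x θ hphase hq hopt hub⟩
    · push Not at hfeas
      exact ⟨_, .pruneInfeasible st n q hphase hq hfeas⟩
  | sub n x θ =>
    choose res hres using fun s j => P.exists_solves s j (st.arcs s j) x (hdual s j)
    by_cases hneg : ∃ s j a, P.reducedCost s j a (res s j) < 0
    · exact ⟨_, .addArcs st n x θ res (fun s j => {a | P.reducedCost s j a (res s j) < 0}) hphase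
        hres hneg (fun s j a ha => ha) (fun s j ha => ha)⟩
    push Not at hneg
    by_cases hviol : ∃ s j, P.Violated s j x (θ s j) (res s j)
    · exact ⟨_, .addCuts st n x θ res hphase hres hneg hviol⟩
    push Not at hviol
    by_cases hint : P.Integral x
    -- An infeasibility answer always violates its own cut, so without violation every relaxation is
    -- solved.
    · have hsolved : ∀ s j, ∃ y w, res s j = .solved y w := by
        intro s j
        cases hr : res s j with
        | solved y w => exact ⟨y, w, rfl⟩
        | infeasible r =>
          have h1 := hres s j
          have h2 := hviol s j
          rw [hr] at h1 h2
          exact absurd h1.2.2 h2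
      choose y w hyw using hsolved
      simp only [hyw] at hres hneg hviol
      rcases le_or_gt st.ub (P.total x y : WithTop ℝ) with hub | hub
      · exact ⟨_, .pruneLower st n x θ y w hphase hres hneg hviol hint hub⟩
      · obtain ⟨q, hexp⟩ := P.exists_expansion R n
        exact ⟨_, .store st n x θ y w st.ub q hphase hres hneg hviol hint hub (Or.inl rfl) hexp⟩
    · exact ⟨_, .separated st n x θ res hphase hres hneg hviol hint⟩
  | frac n x =>
    simp only [PhaseOk, hphase, Integral] at hok
    obtain ⟨-, hfrac⟩ := hok
    push Not at hfrac
    obtain ⟨k, hk, hfrac⟩ := hfrac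
    exact ⟨_, .branch st n x k hphase hk hfrac⟩

/-! ### Termination -/

/-- The number of Benders cuts that can still be generated. -/
noncomputable def remainingCuts (st : State S J K N A L) : ℕ :=
  ∑ s, ∑ j, ((P.signature s j (P.arcCost s j) '' st.optCuts s j)ᶜ.ncard +
    (P.signature s j 0 '' st.feasCuts s j)ᶜ.ncard)

/-- The number of arcs that are not yet generated. -/
noncomputable def remainingArcs (st : State S J K N A L) : ℕ :=
  ∑ s, ∑ j, (st.arcs s j)ᶜ.ncard

/-- Total weight of the open nodes. -/
noncomputable def openWeight (R : ℕ) (st : State S J K N A L) : ℕ :=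
  (st.openNodes.map (P.weight R)).sum

/-- Progress within the processing of a node. -/
def phaseRank : Phase S J K → ℕ
  | .select => 2
  | .sub _ _ _ => 1
  | .frac _ _ => 0

/-- Termination measure, decreasing lexicographically. -/
noncomputable def measure (R : ℕ) (st : State S J K N A L) : ℕ × ℕ × ℕ × ℕ :=
  (P.remainingCuts st, remainingArcs st, P.openWeight R st, phaseRank st.phase)

/-- The lexicographic order on the values of the measure. -/
abbrev MeasureLt : ℕ × ℕ × ℕ × ℕ → ℕ × ℕ × ℕ × ℕ → Prop :=
  Prod.Lex (· < ·) (Prod.Lex (· < ·) (Prod.Lex (· < ·) (· < ·)))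

theorem sum_sum_lt {f g : S → J → ℕ} (hle : ∀ s j, f s j ≤ g s j)
    (hlt : ∃ s j, f s j < g s j) : ∑ s, ∑ j, f s j < ∑ s, ∑ j, g s j := by
  obtain ⟨s, j, hsj⟩ := hlt
  exact Finset.sum_lt_sum (fun s _ => Finset.sum_le_sum fun j _ => hle s j)
    ⟨s, Finset.mem_univ s, Finset.sum_lt_sum (fun j _ => hle s j) ⟨j, Finset.mem_univ j, hsj⟩⟩

theorem ncard_compl_anti {α : Type*} [Finite α] {s t : Set α} (h : s ⊆ t) :
    tᶜ.ncard ≤ sᶜ.ncard := Set.ncard_le_ncard (Set.compl_subset_compl.2 h)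

theorem ncard_compl_lt {α : Type*} [Finite α] {s t : Set α} (h : s ⊆ t) {a : α} (ha : a ∈ t)
    (has : a ∉ s) : tᶜ.ncard < sᶜ.ncard :=
  Set.ncard_lt_ncard (compl_lt_compl_iff_lt.2 ((Set.ssubset_iff_of_subset h).2 ⟨a, ha, has⟩))

/-- A violated Benders cut is a new one. -/
theorem remainingCuts_lt {st : State S J K N A L} {n : Node K} {x : K → ℝ}
    {θ : S → J → ℝ} {res : ∀ s j, SubResult (N s j) (A s j) (L s j)}
    {O F : ∀ s j, Set (DualVec (N s j) (L s j))} (q : Multiset (Node K))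
    (hO : ∀ s j, O s j = st.optCuts s j ∪ {w | ∃ y, res s j = .solved y w})
    (hF : ∀ s j, F s j = st.feasCuts s j ∪ {r | res s j = .infeasible r})
    (h : P.Invariant st) (hopt : P.MasterFeasible st n x θ)
    (hviol : ∃ s j, P.Violated s j x (θ s j) (res s j)) (ph : Phase S J K) :
    P.remainingCuts { st with queue := q, phase := ph, optCuts := O, feasCuts := F } <
      P.remainingCuts st := by
  have hOs : ∀ s j, st.optCuts s j ⊆ O s j := fun s j => by
    rw [hO]
    exact Set.subset_union_left
  have hFs : ∀ s j, st.feasCuts s j ⊆ F s j := fun s j => by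
    rw [hF]
    exact Set.subset_union_left
  refine sum_sum_lt (fun s j => add_le_add (ncard_compl_anti (Set.image_mono (hOs s j)))
    (ncard_compl_anti (Set.image_mono (hFs s j)))) ?_
  obtain ⟨s, j, hv⟩ := hviol
  refine ⟨s, j, ?_⟩
  cases hr : res s j with
  | solved y w =>
    rw [hr] at hv
    have hw : w ∈ O s j := by
      rw [hO]
      exact Or.inr ⟨y, hr⟩
    refine add_lt_add_of_lt_of_le
      (ncard_compl_lt (Set.image_mono (hOs s j)) (Set.mem_image_of_mem _ hw) ?_)
      (ncard_compl_anti (Set.image_mono (hFs s j)))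
    -- An earlier cut of the same signature would be this very cut, which the master solution
    -- satisfies. For rays it would be a positive multiple.
    · rintro ⟨w', hw', hsig⟩
      obtain rfl := BasicPoint.eq_of_signature (h.2 s j w' hw') hsig
      exact absurd (hopt.2.1 s j w hw') (not_le.2 hv)
  | infeasible r =>
    rw [hr] at hv
    have hrF : r ∈ F s j := by
      rw [hF]
      exact Or.inr hr
    refine add_lt_add_of_le_of_lt (ncard_compl_anti (Set.image_mono (hOs s j)))
      (ncard_compl_lt (Set.image_mono (hFs s j)) (Set.mem_image_of_mem _ hrF) ?_)
    · rintro ⟨r', hr', hsig⟩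
      obtain ⟨t, ht, rfl⟩ := BasicRay.exists_pos_smul_of_signature (h.3 s j r' hr') hsig
      have h1 : 0 < t * P.dualObj s j x r' := by
        have : P.dualObj s j x (t • r') = t * P.dualObj s j x r' := by
          rw [← dualObjLin_apply, map_smul, smul_eq_mul, dualObjLin_apply]
        exact this ▸ hv
      exact absurd (hopt.2.2 s j r' hr') (not_le.2 (pos_of_mul_pos_right h1 ht.le))

/-- New Benders cuts lower the first component and new arcs the second. Pruning, storing, cutting
and branching lower the weight. The other steps only advance the phase; the node held by the phase
still counts as open, so the weight is unchanged. -/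
theorem Invariant.measure_lt {P : Program S J K M N A L} {R : ℕ} {st st' : State S J K N A L}
    (h : P.Invariant st) (hstep : P.Step R st st') :
    MeasureLt (P.measure R st') (P.measure R st) := by
  have hok := h.phase_ok
  have hnodes : ∀ {st' : State S J K N A L}, P.remainingCuts st' = P.remainingCuts st →
      remainingArcs st' = remainingArcs st → P.openWeight R st' < P.openWeight R st →
      MeasureLt (P.measure R st') (P.measure R st) := by
    intro st' h1 h2 h3
    unfold measure
    rw [h1, h2]
    exact .right _ (.right _ (.left _ _ h3))
  have hrank : ∀ {st' : State S J K N A L}, P.remainingCuts st' = P.remainingCuts st →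
      remainingArcs st' = remainingArcs st → st'.openNodes = st.openNodes →
      phaseRank st'.phase < phaseRank st.phase →
      MeasureLt (P.measure R st') (P.measure R st) := by
    intro st' h1 h2 h3 h4
    unfold measure openWeight
    rw [h1, h2, h3]
    exact .right _ (.right _ (.right _ h4))
  cases hstep with
  | pruneInfeasible n q hphase hq hinf =>
    refine hnodes rfl rfl ?_
    simp [openWeight, State.openNodes, hphase, hq, P.weight_pos R n]
  | pruneBound n q x θ hphase hq hopt hub =>
    refine hnodes rfl rfl ?_
    simp [openWeight, State.openNodes, hphase, hq, P.weight_pos R n]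
  | enterSub n q x θ hphase hq hopt hub =>
    refine hrank rfl rfl ?_ ?_
    · simp [State.openNodes, hphase, hq]
    · simp [phaseRank, hphase]
  | enterFrac n q x θ hphase hq hopt hub hfrac =>
    refine hrank rfl rfl ?_ ?_
    · simp [State.openNodes, hphase, hq]
    · simp [phaseRank, hphase]
  | addArcs n x θ res new hphase hres hneg hnew hadd =>
    refine .right _ (.left _ _ ?_)
    refine sum_sum_lt (fun s j => ncard_compl_anti Set.subset_union_left) ?_
    obtain ⟨s, j, hneg⟩ := hneg
    obtain ⟨a, ha⟩ := hadd s j hneg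
    refine ⟨s, j, ncard_compl_lt Set.subset_union_left (Or.inr ha) fun ha' => ?_⟩
    exact absurd (P.reducedCost_nonneg s j (hres s j) ha') (not_le.2 (hnew s j a ha))
  | addCuts n x θ res hphase hres hprice hviol =>
    simp only [PhaseOk, hphase] at hok
    exact .left _ _ (P.remainingCuts_lt _ (fun _ _ => rfl) (fun _ _ => rfl) h hok.1 hviol _)
  | separated n x θ res hphase hres hprice hviol hfrac =>
    refine hrank rfl rfl ?_ ?_
    · simp [State.openNodes, hphase]
    · simp [phaseRank, hphase]
  | pruneLower n x θ y w hphase hres hprice hviol hint hub =>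
    refine hnodes rfl rfl ?_
    simp [openWeight, State.openNodes, hphase, P.weight_pos R n]
  | store n x θ y w u q hphase hres hprice hviol hint hub hu hexp =>
    refine hnodes rfl rfl ?_
    simpa [openWeight, State.openNodes, hphase] using P.sum_weight_expansion_lt R hexp
  | mioCut n x c m hphase hround hvalid hcut =>
    refine hnodes rfl rfl ?_
    simp only [openWeight, State.openNodes, hphase, Multiset.map_cons, Multiset.sum_cons,
      add_lt_add_iff_right, weight, hround]
    exact Nat.pow_lt_pow_right (by norm_num) (Nat.add_lt_add_left (Nat.lt_succ_self m) _)
  | branch n x k hphase hk hfrac =>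
    simp only [PhaseOk, hphase] at hok
    refine hnodes rfl rfl ?_
    simpa [openWeight, State.openNodes, hphase] using P.sum_weight_children_lt R hk
      (P.lo_le_floor hok.1 hk) (P.floor_lt_hi hok.1 hk hfrac)

theorem no_infinite_run
    (hlink : ∀ s j n k, P.block k = j → k ∉ P.intIdx → P.supply s j n k = 0) (R : ℕ) :
    ¬ ∃ run : ℕ → State S J K N A L, P.Init R (run 0) ∧ ∀ i, P.Step R (run i) (run (i + 1)) := by
  rintro ⟨run, h0, hstep⟩
  have hinv : ∀ i, P.Invariant (run i) := fun i => by
    induction i with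
    | zero => exact .of_init h0
    | succ i ih => exact ih.step hlink (hstep i)
  have hwf : WellFounded MeasureLt := IsWellFounded.wf
  exact (wellFounded_iff_isEmpty_descending_chain.1 hwf).false
    ⟨fun i => P.measure R (run i), fun i => (hinv i).measure_lt (hstep i)⟩

/-! ### Correctness of the result -/

theorem Invariant.feasible_of_pool {P : Program S J K M N A L} {st : State S J K N A L}
    (h : P.Invariant st) {x : K → ℝ} (hx : x ∈ st.pool) {y : ∀ s j, A s j → ℝ}
    (hy : P.Recourse x y) : P.Feasible x y := ⟨(h.pool_mem x hx).1, (h.pool_mem x hx).2, hy⟩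

theorem Invariant.poolBound_of_terminal {P : Program S J K M N A L} {st : State S J K N A L}
    (h : P.Invariant st) (hst : st.Terminal) {x : K → ℝ} {y : ∀ s j, A s j → ℝ}
    (hxy : P.Feasible x y) : P.PoolBound st.pool (P.total x y) := by
  refine (h.covered x y hxy).resolve_left ?_
  rintro ⟨n, hn, -⟩
  simp [State.openNodes, hst.1, hst.2] at hn

/-- Arc domains are arbitrary, so a completion problem need not attain its infimum by itself; a best
completion exists because the pool matches the given optimum and all its completions are feasible.
-/
theorem Invariant.output_optimal {P : Program S J K M N A L} {st : State S J K N A L}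
    (h : P.Invariant st) (hst : st.Terminal) (hopt : ∃ x y, P.Optimal x y) :
    (∃ x y, P.Output st x y) ∧ ∀ x y, P.Output st x y → P.Optimal x y := by
  obtain ⟨x₀, y₀, hfeas, hmin⟩ := hopt
  obtain ⟨x, hx, y, hy, hle⟩ := h.poolBound_of_terminal hst hfeas
  refine ⟨⟨x, y, hx, hy, fun x' hx' y' hy' => ?_⟩, fun x' y' hout => ?_⟩
  · exact hle.trans (hmin x' y' (h.feasible_of_pool hx' hy'))
  · refine ⟨h.feasible_of_pool hout.1 hout.2.1, fun x'' y'' hxy => ?_⟩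
    exact (hout.2.2 x hx y hy).trans (hle.trans (hmin x'' y'' hxy))

end TwoStage.Program

/-- Finite convergence of the unified branch-and-double-decomposition algorithm: it can be started,
it has no infinite run, it never gets stuck before the queue is empty, and when the queue is empty
the post-processing of the stored first-stage solutions gives an optimal solution of the two-stage
mixed-integer program, or finds that no stored solution can be completed if that program is
infeasible. -/
theorem theorem3 {S J K M : Type*} {N A L : S → J → Type*}
    [Fintype S] [Fintype J] [Fintype K] [Fintype M]
    [∀ s j, Fintype (N s j)] [∀ s j, Fintype (A s j)] [∀ s j, Fintype (L s j)]
    (P : TwoStage.Program S J K M N A L)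
    (hbounded : Bornology.IsBounded P.firstStage)
    (hlink : ∀ s j n k, P.block k = j → k ∉ P.intIdx → P.supply s j n k = 0)
    (hdual : ∀ s j, (P.dualPoly s j Set.univ).Nonempty)
    (R : ℕ) :
    (∃ st, P.Init R st) ∧
    (¬ ∃ run : ℕ → TwoStage.State S J K N A L,
      P.Init R (run 0) ∧ ∀ i, P.Step R (run i) (run (i + 1))) ∧
    (∀ st, P.Reachable R st → ¬ st.Terminal → ∃ st', P.Step R st st') ∧
    (∀ st, P.Reachable R st → st.Terminal →
      ((∃ x y, P.Optimal x y) →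
        (∃ x y, P.Output st x y) ∧ ∀ x y, P.Output st x y → P.Optimal x y) ∧
      ((¬ ∃ x y, P.Feasible x y) → ∀ x ∈ st.pool, ¬ ∃ y, P.Recourse x y)) := by
  refine ⟨P.exists_init hbounded hdual R, P.no_infinite_run hlink R,
    fun st hst hterm => (hst.invariant hlink).exists_step hbounded hdual hterm,
    fun st hst hterm => ⟨(hst.invariant hlink).output_optimal hterm, ?_⟩⟩
  rintro hinf x hx ⟨y, hy⟩
  exact hinf ⟨x, y, (hst.invariant hlink).feasible_of_pool hx hy⟩
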